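/- Let $\vec{\mathbb T}=(\mathbb V,\vec{\mathbb E})$ be a directed tree with countably many vertices, that is, a tree whose edges are oriented so that each vertex $x$ has exactly one parent $p(x)$ and at least one child; the directed edges are the pairs $xp(x)$. A height function is a map $h:\mathbb V\to\mathbb Z$; it is *monotone* if $h(p(x))\ge h(x)$ for all $x$. Let $\mathcal F$ be the product sigma-algebra on $\Omega=\mathbb Z^{\mathbb V}$, let $\mathcal F^\nabla\subset\mathcal F$ be the sigma-algebra generated by the height differences $h(y)-h(x)$, and let $\mathcal T=\bigcap_{\Lambda}\sigma(h(x):x\notin\Lambda)$, over finite $\Lambda\subset\mathbb V$, be the tail sigma-algebra. For $\Lambda\subset\mathbb V$ finite and $b$ monotone, let $\gamma_\Lambda(\cdot,b)$ be the uniform probability measure on the finite set of monotone functions that agree with $b$ outside $\Lambda$. A *Gibbs measure* (respectively *gradient Gibbs measure*) is a probability measure $\mu$ on $\mathcal F$ (respectively $\mathcal F^\nabla$) that is supported on monotone functions and satisfies $\mu\gamma_\Lambda=\mu$ for every finite $\Lambda$. A gradient Gibbs measure is *localised* if it is the restriction to $\mathcal F^\nabla$ of a Gibbs measure. A *flow*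 is a map $\phi:\vec{\mathbb E}\to(0,\infty]$ with $\phi_{xp(x)}=\sum_{y:\,p(y)=x}\phi_{yx}$ for all $x$. Its *flow measure* $\mu_\phi$ is the probability measure on $\mathcal F^\nabla$ under which the increments $h(p(x))-h(x)$, $x\in\mathbb V$, are independent, and $h(p(x))-h(x)$ takes each value $k\in\{0,1,2,\dots\}$ with probability $(1-e^{-\phi_{xp(x)}})e^{-k\phi_{xp(x)}}$ (with $e^{-\infty}=0$ and $0^0=1$). **Theorem (localisation criterion).** Let $\phi$ be a flow. There is exactly one such measure $\mu_\phi$, and it is a gradient Gibbs measure. The following are equivalent: 1. $\mu_\phi$ is localised; 2. $\sum_{y\in A(x)}e^{-\phi_{yp(y)}}<\infty$ for some $x\in\mathbb V$; 3. $\sum_{y\in A(x)}e^{-\phi_{yp(y)}}<\infty$ for every $x\in\mathbb V$, where $A(x)=\{x,p(x),p(p(x)),\dots\}$ is the set of ancestors of $x$. Moreover: * If the sum converges, then the limit of the heights along the ancestors is a height offset variable for $\mu_\phi$: there is a $\mathcal T$-measurable $H:\Omega\to\mathbb R\cup\{\infty\}$ with $H(h+a)=H(h)+a$ for all $h\in\Omega$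 and $a\in\mathbb Z$ and with $\mu_\phi(H<\infty)=1$, such that $H(h)=\lim_{n\to\infty}h(p^n(x))$ for every monotone $h$ and every $x\in\mathbb V$. * If the sum diverges, then for every $x\in\mathbb V$ the averaged finite-volume variances blow up: $$\lim_{\Lambda\uparrow\mathbb V}\int \operatorname{Var}_{\gamma_\Lambda(\cdot,b)}[h(x)]\,d\mu_\phi(b)=\infty ,$$ the limit being along the finite subsets $\Lambda$ of $\mathbb V$ directed by inclusion. -/

import Mathlib

open MeasureTheory ProbabilityTheory Filter Topology
open scoped ENNReal

/-- A directed tree on the vertex set `V`: a tree together with an orientation of its edges for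
which each vertex `x` has exactly one parent, `parent x`, and at least one child.  The directed
edges are the pairs `(x, parent x)`, hence they are indexed by the child `x`. -/
structure DirectedTree (V : Type*) where
  /-- The underlying undirected graph. -/
  graph : SimpleGraph V
  isTree : graph.IsTree
  /-- The parent of a vertex. -/
  parent : V → V
  adj_parent : ∀ x, graph.Adj x (parent x)
  /-- Each edge is oriented in exactly one way, from the child to the parent. -/
  oriented : ∀ x y, graph.Adj x y → Xor (parent x = y) (parent y = x)
  exists_child : ∀ x, ∃ y, parent y = x

/-- The gradient sigma-algebra: the smallest sigma-algebra on height functions which makes all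
height differences measurable. -/
@[reducible] def gradSigma (V : Type*) : MeasurableSpace (V → ℤ) :=
  ⨆ (x : V) (y : V), MeasurableSpace.comap (fun h : V → ℤ => h y - h x) inferInstance

/-- The gradient sigma-algebra is contained in the product sigma-algebra. -/
theorem gradSigma_le (V : Type*) : gradSigma V ≤ (MeasurableSpace.pi : MeasurableSpace (V → ℤ)) :=
  iSup₂_le fun x y =>
    ((measurable_pi_apply y).sub (measurable_pi_apply x)).comap_le

/-- The sigma-algebra generated by the heights outside the finite set `Λ`. -/
@[reducible] def outsideSigma {V : Type*} (Λ : Finset V) : MeasurableSpace (V → ℤ) :=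
  ⨆ (x : V) (_ : x ∉ Λ), MeasurableSpace.comap (fun h : V → ℤ => h x) inferInstance

/-- The tail sigma-algebra. -/
@[reducible] def tailSigma (V : Type*) : MeasurableSpace (V → ℤ) :=
  ⨅ Λ : Finset V, outsideSigma Λ

/-- A height offset variable: a tail-measurable function with values in `ℝ ∪ {∞}` which satisfies
`H (h + a) = H h + a` for all height functions `h` and all integers `a`. -/
structure IsHeightOffset {V : Type*} (H : (V → ℤ) → EReal) : Prop where
  measurable : Measurable[tailSigma V] H
  ne_bot : ∀ h, H h ≠ ⊥
  add_const : ∀ (h : V → ℤ) (a : ℤ), H (fun x => h x + a) = H h + (((a : ℝ)) : EReal)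

/-- The number `e ^ (-α)` for `α ∈ [0, ∞]`, with `e ^ (-∞) = 0`. -/
noncomputable def expNeg (α : ℝ≥0∞) : ℝ≥0∞ := EReal.exp (-(α : EReal))

namespace DirectedTree

variable {V : Type*} (T : DirectedTree V)

/-- The set of monotone functions: the height of a parent is at least the height of its child. -/
def monotoneFunctions : Set (V → ℤ) := {h | ∀ x, 0 ≤ h (T.parent x) - h x}

/-- The local Gibbs measure in `Λ` with boundary height function `b`: the uniform probability
measure on the (finite) set of monotone functions which agree with `b` outside `Λ`. -/
noncomputable def localGibbs (Λ : Finset V) (b : V → ℤ) : Measure (V → ℤ) :=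
  uniformOn {h | h ∈ T.monotoneFunctions ∧ ∀ x, x ∉ Λ → h x = b x}

/-- `μ` is a probability measure on the sigma-algebra `m` which is supported on monotone functions
and satisfies the Dobrushin-Lanford-Ruelle equations on `m`. -/
structure SatisfiesDLR {m : MeasurableSpace (V → ℤ)} (μ : @Measure (V → ℤ) m) : Prop where
  isProb : IsProbabilityMeasure μ
  supported : μ T.monotoneFunctionsᶜ = 0
  dlr : ∀ (Λ : Finset V) (A : Set (V → ℤ)), MeasurableSet[m] A →
    ∫⁻ b, T.localGibbs Λ b A ∂μ = μ A

/-- Gibbs measures are measures on the product sigma-algebra. -/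
def IsGibbs (ν : Measure (V → ℤ)) : Prop := T.SatisfiesDLR ν

/-- Gradient Gibbs measures are measures on the gradient sigma-algebra. -/
def IsGradientGibbs (μ : @Measure (V → ℤ) (gradSigma V)) : Prop := T.SatisfiesDLR μ

/-- A measure on the gradient sigma-algebra is localised if it is the restriction of a
(non-gradient) Gibbs measure. -/
def Localised (μ : @Measure (V → ℤ) (gradSigma V)) : Prop :=
  ∃ ν : Measure (V → ℤ), T.IsGibbs ν ∧ ν.trim (gradSigma_le V) = μ

/-- Flows with values in `(0, ∞]`; `φ x` is the value on the directed edge from `x` to its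
parent. -/
structure IsFlow (φ : V → ℝ≥0∞) : Prop where
  pos : ∀ x, 0 < φ x
  conservation : ∀ x, φ x = ∑' y : {y : V // T.parent y = x}, φ y

/-- `μ` is the flow measure of `φ`: under `μ` the increments `h (parent x) - h x` are independent,
and the increment at `x` has the geometric distribution on `{0, 1, 2, …}` whose mass at `k` is
proportional to `e ^ (-k * φ x)`. -/
structure IsFlowMeasure (φ : V → ℝ≥0∞) (μ : @Measure (V → ℤ) (gradSigma V)) : Prop where
  isProb : IsProbabilityMeasure μ
  indep : iIndepFun (fun (x : V) (h : V → ℤ) => h (T.parent x) - h x) μ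
  law : ∀ (x : V) (k : ℕ),
    μ {h | h (T.parent x) - h x = (k : ℤ)} = (1 - expNeg (φ x)) * expNeg (φ x) ^ k

/-- The set of ancestors of `x`, with `x` itself included. -/
def ancestors (x : V) : Set V := {y | ∃ n : ℕ, T.parent^[n] x = y}

/-- The localisation criterion at `x`: the sum of `e ^ (-φ y)` over the ancestors `y` of `x` is
finite. -/
def Criterion (φ : V → ℝ≥0∞) (x : V) : Prop :=
  ∑' y : T.ancestors x, expNeg (φ y) < ∞

end DirectedTree

/-! Up to an additive constant a height function is its family of increments, because any two
vertices have a common ancestor. Thus `μ` corresponds to the product `incrLaw` of geometric laws.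
These are memoryless: forcing the increments on a set `Y` to be positive costs the factor exp(-∑_Y
φ) and shifts them by one (`incrLaw_restrict_one_le`). Raising a vertex `v` lowers its own increment
and raises those of its children; by conservation both sides cost the same factor, so the move
preserves the measure. Composing such moves gives invariance under finite modifications, which is
equivalent to the DLR equations.

If the sum converges, Borel–Cantelli makes the heights along the ancestors eventually constant.
Subtracting the eventual height commutes with finite modifications and turns `μ` into a Gibbs
measure (`IsFlowMeasure.localised`).

If the sum diverges, choose finite blocks `B n` containing `o`, with top the n-th ancestor t_n
(`IsFlow.exists_blocks`). Raising `B n` by one carries the event R_n, that the increment at t_n is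
positive, to the event L_n, that all increments just below `B n` are positive; both have probability
exp(-φ(t_n)). The blocks are chosen with almost no common inflow, so the L_n, like the independent
R_n, are nearly uncorrelated. By a second moment bound the numbers of R_n and of L_n that occur are
nearly constant relative to their means, hence nearly independent of any given event. A variable `W`
that increases by one under each of these moves therefore has nearly the same law as `W + 1`, so it
is spread out (`exists_forall_measure_abs_lt_le_half`). Taking `W` to be the height of `o` under a
Gibbs measure contradicts localisation; taking `W` to be the height of `x` minus its local Gibbs
mean makes the variances diverge. -/

namespace DirectedTree

variable {V : Type*} (T : DirectedTree V)

/-! ### Ancestral lines, and height functions as families of increments -/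

lemma parent_parent_ne (x : V) : T.parent (T.parent x) ≠ x := by
  intro h
  rcases T.oriented x (T.parent x) (T.adj_parent x) with ⟨_, h2⟩ | ⟨_, h2⟩
  · exact h2 h
  · exact h2 rfl

lemma parent_iterate_ne (x : V) {k : ℕ} (hk : 0 < k) : T.parent^[k] x ≠ x := by
  classical
  intro hx
  have hex : ∃ k, 0 < k ∧ T.parent^[k] x = x := ⟨k, hk, hx⟩
  obtain ⟨hm0, hmx⟩ := Nat.find_spec hex
  have hmin : ∀ j, 0 < j → j < Nat.find hex → T.parent^[j] x ≠ x :=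
    fun j hj hj' hjx => Nat.find_min hex hj' ⟨hj, hjx⟩
  generalize Nat.find hex = m at hm0 hmx hmin
  -- In a tree the edge from `x` to its parent is a bridge; the remainder of a shortest directed
  -- cycle through `x` would join its endpoints without using it.
  have hbridge := SimpleGraph.isAcyclic_iff_forall_adj_isBridge.1 T.isTree.isAcyclic
    (T.adj_parent x)
  rw [SimpleGraph.isBridge_iff] at hbridge
  refine hbridge ?_
  have key : ∀ j, j + 1 ≤ m →
      (T.graph.deleteEdges {s(x, T.parent x)}).Reachable
        (T.parent x) (T.parent^[j + 1] x) := by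
    intro j
    induction j with
    | zero => intro _; exact SimpleGraph.Reachable.refl _
    | succ j ih =>
      intro hj
      refine (ih (by omega)).trans (SimpleGraph.Adj.reachable ?_)
      rw [Function.iterate_succ_apply' _ (j + 1), SimpleGraph.deleteEdges_adj]
      refine ⟨T.adj_parent _, ?_⟩
      rw [Set.mem_singleton_iff, Sym2.eq_iff]
      rintro (⟨h1, _⟩ | ⟨h1, h2⟩)
      · exact hmin (j + 1) (by omega) (by omega) h1
      · rw [h1] at h2
        exact T.parent_parent_ne x h2
  have := key (m - 1) (by omega)
  rw [show m - 1 + 1 = m by omega, hmx] at this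
  exact this.symm

lemma parent_ne (x : V) : T.parent x ≠ x := T.parent_iterate_ne x one_pos

lemma parent_iterate_injective (x : V) : Function.Injective fun n : ℕ => T.parent^[n] x := by
  have key : ∀ a b : ℕ, a ≤ b → T.parent^[a] x = T.parent^[b] x → a = b := by
    intro a b hab h
    by_contra hne
    refine T.parent_iterate_ne (T.parent^[a] x) (k := b - a) (by omega) ?_
    rw [← Function.iterate_add_apply, show b - a + a = b by omega, h]
  intro a b h
  rcases le_total a b with hab | hab
  · exact key a b hab h
  · exact (key b a hab h.symm).symm

lemma exists_common_ancestor (x y : V) : ∃ n m : ℕ, T.parent^[n] x = T.parent^[m] y := by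
  obtain ⟨w⟩ := T.isTree.connected.preconnected x y
  induction w with
  | nil => exact ⟨0, 0, rfl⟩
  | @cons u v w huv _ ih =>
    obtain ⟨n, m, h⟩ := ih
    rcases T.oriented u v huv with ⟨h1, _⟩ | ⟨h1, _⟩
    · exact ⟨n + 1, m, by rw [Function.iterate_succ_apply, h1, h]⟩
    · refine ⟨n, m + 1, ?_⟩
      rw [Function.iterate_succ_apply', ← h, ← Function.iterate_succ_apply' T.parent n,
        Function.iterate_succ_apply, h1]

/-- The increments of a height function along the edges to the parents. -/
def incr (h : V → ℤ) (x : V) : ℤ := h (T.parent x) - h x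

lemma sum_incr (h : V → ℤ) (x : V) (n : ℕ) :
    ∑ j ∈ Finset.range n, T.incr h (T.parent^[j] x) = h (T.parent^[n] x) - h x := by
  induction n with
  | zero => simp
  | succ n ih => rw [Finset.sum_range_succ, ih, incr, ← Function.iterate_succ_apply' T.parent]; ring

/-- The height function with prescribed increments which vanishes at `o`. -/
noncomputable def integrate (o : V) (d : V → ℤ) (y : V) : ℤ :=
  ∑ j ∈ Finset.range (T.exists_common_ancestor y o).choose_spec.choose, d (T.parent^[j] o) -
    ∑ j ∈ Finset.range (T.exists_common_ancestor y o).choose, d (T.parent^[j] y)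

/-- Two choices of a common ancestor differ by equally many steps along one shared line, and the
increments on these steps cancel. -/
lemma integrate_eq (o : V) (d : V → ℤ) (y : V) {n m : ℕ}
    (h : T.parent^[n] y = T.parent^[m] o) :
    T.integrate o d y =
      ∑ j ∈ Finset.range m, d (T.parent^[j] o) - ∑ j ∈ Finset.range n, d (T.parent^[j] y) := by
  have key : ∀ n m n' m' : ℕ, n ≤ n' → T.parent^[n] y = T.parent^[m] o →
      T.parent^[n'] y = T.parent^[m'] o →
      ∑ j ∈ Finset.range m, d (T.parent^[j] o) - ∑ j ∈ Finset.range n, d (T.parent^[j] y) =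
      ∑ j ∈ Finset.range m', d (T.parent^[j] o) - ∑ j ∈ Finset.range n', d (T.parent^[j] y) := by
    intro n m n' m' hn h h'
    obtain ⟨k, rfl⟩ := Nat.exists_eq_add_of_le hn
    have hm' : m' = m + k := by
      refine T.parent_iterate_injective o ?_
      change T.parent^[m'] o = T.parent^[m + k] o
      rw [← h', add_comm n k, add_comm m k, Function.iterate_add_apply, h,
        Function.iterate_add_apply]
    subst hm'
    rw [Finset.sum_range_add, Finset.sum_range_add]
    have : ∀ j, T.parent^[n + j] y = T.parent^[m + j] o := by
      intro j
      rw [add_comm n, add_comm m, Function.iterate_add_apply, h, Function.iterate_add_apply]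
    simp only [this]
    ring
  have h' := (T.exists_common_ancestor y o).choose_spec.choose_spec
  rcases le_total n (T.exists_common_ancestor y o).choose with hle | hle
  · exact (key _ _ _ _ hle h h').symm
  · exact key _ _ _ _ hle h' h

lemma incr_integrate (o : V) (d : V → ℤ) : T.incr (T.integrate o d) = d := by
  funext y
  obtain ⟨n, m, h⟩ := T.exists_common_ancestor y o
  have h1 : T.parent^[n + 1] y = T.parent^[m + 1] o := by
    rw [Function.iterate_succ_apply', Function.iterate_succ_apply', h]
  have h2 : T.parent^[n] (T.parent y) = T.parent^[m + 1] o := by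
    rw [← h1, Function.iterate_succ_apply]
  rw [incr, T.integrate_eq o d y h1, T.integrate_eq o d _ h2, Finset.sum_range_succ' _ n]
  simp only [Function.iterate_succ_apply, Function.iterate_zero, id]
  ring

lemma integrate_incr (o : V) (h : V → ℤ) (y : V) :
    T.integrate o (T.incr h) y = h y - h o := by
  obtain ⟨n, m, hnm⟩ := T.exists_common_ancestor y o
  rw [T.integrate_eq o _ y hnm, sum_incr, sum_incr, hnm]
  ring

lemma measurable_integrate (o : V) : Measurable (T.integrate o) := by
  unfold integrate
  fun_prop

lemma measurable_incr_grad : Measurable[gradSigma V] T.incr := by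
  refine @measurable_pi_lambda _ _ _ (gradSigma V) _ _ fun x => ?_
  exact Measurable.of_comap_le (le_iSup₂_of_le x (T.parent x) le_rfl)

/-- Summing increments recovers every height difference. Gradient events thus become events for a
product space, where the flow measure is a product measure. -/
lemma gradSigma_eq_comap : gradSigma V = MeasurableSpace.comap T.incr MeasurableSpace.pi := by
  refine le_antisymm (iSup₂_le fun x y => ?_) T.measurable_incr_grad.comap_le
  obtain ⟨o⟩ := T.isTree.connected.nonempty
  have : (fun h : V → ℤ => h y - h x) =
      (fun d => T.integrate o d y - T.integrate o d x) ∘ T.incr := by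
    funext h
    simp [integrate_incr]
  rw [this, ← MeasurableSpace.comap_comp]
  refine MeasurableSpace.comap_mono (Measurable.comap_le ?_)
  have := T.measurable_integrate o
  fun_prop

lemma measurableSet_grad_iff {A : Set (V → ℤ)} :
    MeasurableSet[gradSigma V] A ↔ ∃ A', MeasurableSet A' ∧ T.incr ⁻¹' A' = A := by
  rw [T.gradSigma_eq_comap, MeasurableSpace.measurableSet_comap]

lemma incr_add (h f : V → ℤ) : T.incr (h + f) = T.incr h + T.incr f := by
  funext x
  simp only [incr, Pi.add_apply]
  ring

lemma incr_add_const (h : V → ℤ) (a : ℤ) : T.incr (fun x => h x + a) = T.incr h := by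
  funext x
  simp [incr]

lemma add_const_mem_iff (T : DirectedTree V) {A : Set (V → ℤ)} (hA : MeasurableSet[gradSigma V] A) (h : V → ℤ)
    (a : ℤ) : (fun x => h x + a) ∈ A ↔ h ∈ A := by
  obtain ⟨A', _, rfl⟩ := T.measurableSet_grad_iff.1 hA
  simp [Set.mem_preimage, incr_add_const]

lemma mem_monotoneFunctions {h : V → ℤ} : h ∈ T.monotoneFunctions ↔ ∀ x, 0 ≤ T.incr h x := Iff.rfl

lemma measurableSet_monotoneFunctions [Countable V] :
    MeasurableSet[gradSigma V] T.monotoneFunctions := by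
  refine T.measurableSet_grad_iff.2 ⟨{d | ∀ x, 0 ≤ d x}, ?_, rfl⟩
  simp only [Set.ofPred_forall]
  exact MeasurableSet.iInter fun x => measurableSet_le measurable_const (measurable_pi_apply x)
end DirectedTree

/-! ### The geometric distribution -/

lemma expNeg_zero : expNeg 0 = 1 := by simp [expNeg]

lemma expNeg_top : expNeg ∞ = 0 := by simp [expNeg]

lemma expNeg_add (a b : ℝ≥0∞) : expNeg (a + b) = expNeg a * expNeg b := by
  rw [expNeg, expNeg, expNeg, EReal.coe_ennreal_add, ← EReal.exp_add,
    EReal.neg_add (Or.inl (by simp)) (Or.inr (by simp)), sub_eq_add_neg]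

lemma expNeg_antitone : Antitone expNeg := fun _ _ h =>
  EReal.exp_monotone (EReal.neg_le_neg_iff.2 (EReal.coe_ennreal_le_coe_ennreal_iff.2 h))

lemma expNeg_le_one (a : ℝ≥0∞) : expNeg a ≤ 1 := by
  rw [← expNeg_zero]; exact expNeg_antitone zero_le

lemma expNeg_ne_top (a : ℝ≥0∞) : expNeg a ≠ ∞ := ((expNeg_le_one a).trans_lt (by simp)).ne

lemma expNeg_lt_one {a : ℝ≥0∞} (ha : 0 < a) : expNeg a < 1 := by
  rw [expNeg, EReal.exp_lt_one_iff, EReal.neg_lt_zero]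
  exact_mod_cast ha

lemma continuous_expNeg : Continuous expNeg :=
  EReal.expHomeomorph.continuous.comp (continuous_neg.comp continuous_coe_ennreal_ereal)

lemma expNeg_sum {ι : Type*} (s : Finset ι) (f : ι → ℝ≥0∞) :
    expNeg (∑ i ∈ s, f i) = ∏ i ∈ s, expNeg (f i) := by
  classical
  induction s using Finset.induction_on with
  | empty => simp [expNeg_zero]
  | insert a s ha ih => rw [Finset.sum_insert ha, Finset.prod_insert ha, expNeg_add, ih]

/-- The weights of the geometric distribution on `{0, 1, 2, …} ⊆ ℤ`. -/
noncomputable def geomWeight (α : ℝ≥0∞) (n : ℤ) : ℝ≥0∞ :=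
  if 0 ≤ n then (1 - expNeg α) * expNeg α ^ n.toNat else 0

/-- The geometric distribution on `{0, 1, 2, …} ⊆ ℤ` with mass at `k` proportional to
`e ^ (-k * α)`. -/
noncomputable def geom (α : ℝ≥0∞) : Measure ℤ :=
  Measure.sum fun n => geomWeight α n • Measure.dirac n

lemma geom_singleton (α : ℝ≥0∞) (n : ℤ) : geom α {n} = geomWeight α n :=
  Measure.sum_smul_dirac_singleton

lemma tsum_geomWeight {α : ℝ≥0∞} (hα : 0 < α) : ∑' n, geomWeight α n = 1 := by
  have hsupp : Function.support (geomWeight α) ⊆ Set.range ((↑) : ℕ → ℤ) := by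
    intro n hn
    by_contra h
    refine hn (if_neg fun h0 => h ⟨n.toNat, Int.toNat_of_nonneg h0⟩)
  rw [← (Nat.cast_injective (R := ℤ)).tsum_eq hsupp]
  simp only [geomWeight, Int.natCast_nonneg, if_true, Int.toNat_natCast]
  rw [ENNReal.tsum_mul_left, ENNReal.tsum_geometric]
  exact ENNReal.mul_inv_cancel (tsub_pos_of_lt (expNeg_lt_one hα)).ne'
    (ENNReal.sub_ne_top ENNReal.one_ne_top)

lemma isProbabilityMeasure_geom {α : ℝ≥0∞} (hα : 0 < α) : IsProbabilityMeasure (geom α) := by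
  refine ⟨?_⟩
  rw [geom, Measure.sum_apply _ MeasurableSet.univ]
  simpa using tsum_geomWeight hα

/-- Memorylessness in one coordinate: each mass is `expNeg α` times the preceding one. -/
lemma geom_restrict_Ici_one (α : ℝ≥0∞) :
    (geom α).restrict (Set.Ici 1) = expNeg α • (geom α).map (fun n => n + 1) := by
  refine Measure.ext_of_singleton fun n => ?_
  rw [Measure.restrict_apply (measurableSet_singleton n), Measure.smul_apply,
    Measure.map_apply (by fun_prop) (measurableSet_singleton n)]
  have hpre : (fun k : ℤ => k + 1) ⁻¹' {n} = {n - 1} := by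
    ext k; simp only [Set.mem_preimage, Set.mem_singleton_iff]; omega
  rw [hpre, geom_singleton, smul_eq_mul]
  by_cases hn : 1 ≤ n
  · rw [Set.inter_eq_left.2 (by simpa using hn), geom_singleton, geomWeight, geomWeight,
      if_pos (by omega), if_pos (by omega), show n.toNat = (n - 1).toNat + 1 by omega, pow_succ]
    ring
  · rw [Set.singleton_inter_eq_empty.2 (by simpa using hn), geomWeight, if_neg (by omega)]
    simp

/-- The prescribed masses already sum to one, which leaves nothing for the negative integers. -/
lemma eq_geom_of_apply_natCast {α : ℝ≥0∞} (hα : 0 < α) (μ : Measure ℤ) [IsProbabilityMeasure μ]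
    (h : ∀ k : ℕ, μ {(k : ℤ)} = (1 - expNeg α) * expNeg α ^ k) : μ = geom α := by
  have hw : ∀ k : ℕ, μ {(k : ℤ)} = geomWeight α k := fun k => by simp [h, geomWeight]
  have h1 : μ (Set.Ici 0) = 1 := by
    have hU : Set.Ici (0 : ℤ) = ⋃ k : ℕ, {(k : ℤ)} := by
      ext n
      simp only [Set.mem_Ici, Set.mem_iUnion, Set.mem_singleton_iff]
      exact ⟨fun hn => ⟨n.toNat, by omega⟩, fun ⟨k, hk⟩ => by omega⟩
    rw [hU, measure_iUnion (fun i j hij => by simpa using hij) fun _ => measurableSet_singleton _]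
    simp only [h]
    rw [ENNReal.tsum_mul_left, ENNReal.tsum_geometric]
    exact ENNReal.mul_inv_cancel (tsub_pos_of_lt (expNeg_lt_one hα)).ne'
      (ENNReal.sub_ne_top ENNReal.one_ne_top)
  refine Measure.ext_of_singleton fun n => ?_
  rw [geom_singleton]
  by_cases hn : 0 ≤ n
  · lift n to ℕ using hn
    exact hw n
  · rw [geomWeight, if_neg hn]
    refine measure_mono_null (t := (Set.Ici 0)ᶜ) (by simpa using hn) ?_
    rwa [prob_compl_eq_zero_iff measurableSet_Ici]

/-! ### Memorylessness for independent geometric increments -/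

section Product

variable {V : Type*} [Countable V] {φ : V → ℝ≥0∞}

/-- The law of independent geometric increments. -/
noncomputable def incrLaw (φ : V → ℝ≥0∞) : Measure (V → ℤ) :=
  Measure.infinitePi fun x => geom (φ x)

lemma measurableSet_one_le (Y : Set V) : MeasurableSet {d : V → ℤ | ∀ y ∈ Y, 1 ≤ d y} := by
  simp only [Set.ofPred_forall]
  exact MeasurableSet.iInter fun y => MeasurableSet.iInter fun _ =>
    measurableSet_le measurable_const (measurable_pi_apply y)

/-- Memorylessness: conditioning a family of increments to be positive shifts these increments. -/
lemma incrLaw_restrict_one_le (hφ : ∀ x, 0 < φ x) (Y : Set V) :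
    (incrLaw φ).restrict {d | ∀ y ∈ Y, 1 ≤ d y} =
      expNeg (∑' y : Y, φ y) • (incrLaw φ).map (fun d => d + Y.indicator 1) := by
  classical
  have hprob : ∀ x, IsProbabilityMeasure (geom (φ x)) := fun x => isProbabilityMeasure_geom (hφ x)
  have hprob' : ∀ x, IsProbabilityMeasure ((geom (φ x)).map fun n : ℤ => n + Y.indicator 1 x) :=
    fun x => Measure.isProbabilityMeasure_map (by fun_prop)
  have hmap : (incrLaw φ).map (fun d => d + Y.indicator 1) =
      Measure.infinitePi fun x => (geom (φ x)).map fun n : ℤ => n + Y.indicator 1 x :=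
    Measure.infinitePi_map_pi (fun x => geom (φ x))
      (f := fun x (n : ℤ) => n + Y.indicator 1 x) (fun x => by fun_prop)
  have : IsProbabilityMeasure (incrLaw φ) := by unfold incrLaw; infer_instance
  -- Extending `φ` by zero off `Y` makes `expNeg (e x)` the cost of coordinate `x` in both cases.
  set e : V → ℝ≥0∞ := Y.indicator φ with he
  have hcoord : ∀ (x : V) (t : Set ℤ),
      geom (φ x) (t ∩ {n | x ∈ Y → 1 ≤ n}) =
        (geom (φ x)).map (fun n : ℤ => n + Y.indicator 1 x) t * expNeg (e x) := by
    intro x t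
    have ht : MeasurableSet t := .of_discrete
    by_cases hx : x ∈ Y
    · have h1 : {n : ℤ | x ∈ Y → 1 ≤ n} = Set.Ici 1 := by ext; simp [hx]
      rw [h1, ← Measure.restrict_apply ht, geom_restrict_Ici_one]
      simp [he, hx, mul_comm]
    · simp [he, hx, expNeg_zero]
  have hbox : ∀ (s : Finset V) (t : V → Set ℤ),
      (incrLaw φ).restrict {d | ∀ y ∈ Y, 1 ≤ d y} (Set.pi s t) =
      expNeg (∑' y : Y, φ y) *
        ∏ x ∈ s, (geom (φ x)).map (fun n : ℤ => n + Y.indicator 1 x) (t x) := by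
    intro s t
    set t' : V → Set ℤ := fun x => if x ∈ s then t x else Set.univ with ht'
    have hset : Set.pi s t ∩ {d : V → ℤ | ∀ y ∈ Y, 1 ≤ d y} =
        Set.univ.pi fun x => t' x ∩ {n | x ∈ Y → 1 ≤ n} := by
      ext d
      simp only [ht', Set.mem_inter_iff, Set.mem_pi, Finset.mem_coe, Set.mem_ofPred_eq,
        Set.mem_univ, forall_true_left]
      refine ⟨fun h x => ⟨?_, fun hx => h.2 x hx⟩, fun h => ⟨fun x hx => ?_, fun y hy => (h y).2 hy⟩⟩
      · split_ifs with hx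
        · exact h.1 x hx
        · trivial
      · simpa [hx] using (h x).1
    rw [Measure.restrict_apply (MeasurableSet.pi s.countable_toSet fun _ _ => .of_discrete), hset,
      incrLaw, Measure.infinitePi_pi_univ _ (fun _ => .of_discrete),
      ENNReal.tprod_eq_iInf_prod fun _ => prob_le_one]
    -- `Y` may be infinite, so the cost is obtained as a limit over finite sets. Continuity of
    -- `expNeg` at ∞ includes a divergent sum, where both sides vanish.
    refine tendsto_nhds_unique (tendsto_atTop_iInf fun a b hab => ?_) ?_ (l := atTop)
    · exact Finset.prod_le_prod_of_subset_of_le_one' hab fun _ _ _ => prob_le_one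
    · have hsum : Tendsto (fun u : Finset V => expNeg (∑ x ∈ u, e x) *
          ∏ x ∈ s, (geom (φ x)).map (fun n : ℤ => n + Y.indicator 1 x) (t x)) atTop
          (𝓝 (expNeg (∑' y : Y, φ y) *
            ∏ x ∈ s, (geom (φ x)).map (fun n : ℤ => n + Y.indicator 1 x) (t x))) := by
        refine ENNReal.Tendsto.mul_const ?_ (Or.inr ?_)
        · rw [tsum_subtype Y φ]
          exact (continuous_expNeg.tendsto _).comp ENNReal.summable.hasSum
        · exact ENNReal.prod_ne_top fun _ _ => measure_ne_top _ _
      refine hsum.congr' ?_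
      filter_upwards [eventually_ge_atTop s] with u hu
      simp only [hcoord, Finset.prod_mul_distrib, expNeg_sum]
      rw [mul_comm]
      congr 1
      rw [← Finset.prod_subset hu]
      · exact Finset.prod_congr rfl fun x hx => by simp [ht', hx]
      · intro x _ hx
        simp [ht', hx]
  have huniv := hbox ∅ fun _ => Set.univ
  simp only [Finset.coe_empty, Set.empty_pi, Finset.prod_empty, mul_one] at huniv
  refine ext_of_generate_finite _ generateFrom_squareCylinders.symm
    (isPiSystem_squareCylinders (fun _ => MeasurableSpace.isPiSystem_measurableSet) (by simp)) ?_ ?_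
  · rintro _ ⟨s, t, ht, rfl⟩
    rw [hbox, Measure.smul_apply, hmap, Measure.infinitePi_pi _ fun _ _ => .of_discrete,
      smul_eq_mul]
  · have : IsProbabilityMeasure ((incrLaw φ).map (fun d => d + Y.indicator 1)) :=
      Measure.isProbabilityMeasure_map (by fun_prop)
    rw [huniv, Measure.smul_apply, measure_univ, smul_eq_mul, mul_one]

lemma isProbabilityMeasure_incrLaw {V : Type*} {φ : V → ℝ≥0∞} (hφ : ∀ x, 0 < φ x) : IsProbabilityMeasure (incrLaw φ) := by
  have hprob : ∀ x, IsProbabilityMeasure (geom (φ x)) := fun x => isProbabilityMeasure_geom (hφ x)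
  unfold incrLaw
  infer_instance

lemma incrLaw_one_le (hφ : ∀ x, 0 < φ x) (Y : Set V) :
    incrLaw φ {d | ∀ y ∈ Y, 1 ≤ d y} = expNeg (∑' y : Y, φ y) := by
  have := isProbabilityMeasure_incrLaw hφ
  have : IsProbabilityMeasure ((incrLaw φ).map (fun d => d + Y.indicator 1)) :=
      Measure.isProbabilityMeasure_map (by fun_prop)
  have h := congrArg (fun m => m Set.univ) (incrLaw_restrict_one_le hφ Y)
  simpa using h

end Product

/-! ### The flow measure as a product law -/

namespace DirectedTree

variable {V : Type*} [Countable V] (T : DirectedTree V) {φ : V → ℝ≥0∞}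

lemma IsFlow.children (hφ : T.IsFlow φ) (x : V) : ∑' y : {y | T.parent y = x}, φ y = φ x :=
  (hφ.conservation x).symm

/-- This identity joins two uses of memorylessness: a shift at `v` followed by raising `v` is a
shift at all children of `v`. -/
lemma incr_single [DecidableEq V] (v : V) :
    T.incr (Pi.single v 1) + ({v} : Set V).indicator 1 = {y | T.parent y = v}.indicator 1 := by
  funext x
  by_cases h1 : x = v
  · subst h1
    simp [incr, T.parent_ne]
  · by_cases h2 : T.parent x = v
    · subst h2
      simp [incr, h1]
    · simp [incr, h1, h2]

/-- Raising a single vertex by one preserves the law of the increments, where possible. -/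
lemma incrLaw_map_raise [DecidableEq V] (hφ : T.IsFlow φ) (v : V) :
    ((incrLaw φ).restrict {d | 1 ≤ d v}).map (fun d => d + T.incr (Pi.single v 1)) =
      (incrLaw φ).restrict {d | ∀ y, T.parent y = v → 1 ≤ d y} := by
  have h1 : {d : V → ℤ | 1 ≤ d v} = {d | ∀ y ∈ ({v} : Set V), 1 ≤ d y} := by simp
  have h2 := incrLaw_restrict_one_le hφ.pos {y | T.parent y = v}
  rw [IsFlow.children T hφ] at h2
  rw [h1, incrLaw_restrict_one_le hφ.pos, Measure.map_smul, Measure.map_map (by fun_prop)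
    (by fun_prop)]
  refine Eq.trans ?_ h2.symm
  rw [tsum_singleton]
  congr 2
  funext d
  simp only [Function.comp_apply]
  rw [add_assoc, add_comm (Set.indicator _ _), incr_single]

lemma IsFlowMeasure.map_incr {μ : @Measure (V → ℤ) (gradSigma V)} (hφ : T.IsFlow φ)
    (hμ : T.IsFlowMeasure φ μ) : @Measure.map _ _ (gradSigma V) _ T.incr μ = incrLaw φ := by
  have := hμ.isProb
  have hm : ∀ x, Measurable[gradSigma V] fun h : V → ℤ => h (T.parent x) - h x := fun x =>
    (measurable_pi_apply x).comp T.measurable_incr_grad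
  have h := (iIndepFun_iff_map_fun_eq_infinitePi_map (mΩ := gradSigma V) (P := μ) hm).1 hμ.indep
  refine h.trans ?_
  unfold incrLaw
  congr 1
  funext x
  have := Measure.isProbabilityMeasure_map (m0 := gradSigma V) (μ := μ) (hm x).aemeasurable
  refine @eq_geom_of_apply_natCast _ (hφ.pos x) _ this fun k => ?_
  rw [Measure.map_apply (hm x) (measurableSet_singleton _)]
  exact hμ.law x k

lemma IsFlowMeasure.apply_preimage {μ : @Measure (V → ℤ) (gradSigma V)} (hφ : T.IsFlow φ)
    (hμ : T.IsFlowMeasure φ μ) {A : Set (V → ℤ)} (hA : MeasurableSet A) :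
    μ (T.incr ⁻¹' A) = incrLaw φ A := by
  rw [← hμ.map_incr T hφ, Measure.map_apply T.measurable_incr_grad hA]

/-- `s` is a section of the family `X`, so `X` has the product law under the image measure. The
sigma-algebra on the target is left free in order to allow `gradSigma V`. -/
lemma exists_isFlowMeasure_aux {Ω : Type*} {m : MeasurableSpace Ω} (hφ : ∀ x, 0 < φ x)
    (s : (V → ℤ) → Ω) (hs : Measurable s) (X : V → Ω → ℤ) (hX : ∀ x, Measurable (X x))
    (hXs : ∀ d x, X x (s d) = d x) :
    IsProbabilityMeasure ((incrLaw φ).map s) ∧ iIndepFun X ((incrLaw φ).map s) ∧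
      ∀ x n, (incrLaw φ).map s {ω | X x ω = n} = geomWeight (φ x) n := by
  have hP := isProbabilityMeasure_incrLaw hφ
  have hprob : ∀ x, IsProbabilityMeasure (geom (φ x)) := fun x => isProbabilityMeasure_geom (hφ x)
  have hprob' := Measure.isProbabilityMeasure_map (μ := incrLaw φ) hs.aemeasurable
  have hx : ∀ x, ((incrLaw φ).map s).map (X x) = geom (φ x) := by
    intro x
    rw [Measure.map_map (hX x) hs, ← Measure.infinitePi_map_eval (fun x => geom (φ x)) x]
    congr 1
    funext d
    exact hXs d x
  refine ⟨hprob', ?_, fun x n => ?_⟩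
  · rw [iIndepFun_iff_map_fun_eq_infinitePi_map hX]
    simp only [hx]
    rw [Measure.map_map (measurable_pi_lambda _ hX) hs]
    have : (fun ω x => X x ω) ∘ s = id := by
      funext d x
      exact hXs d x
    rw [this, Measure.map_id]
    rfl
  · rw [← geom_singleton, ← hx x, Measure.map_apply (hX x) (measurableSet_singleton _)]
    rfl

theorem existsUnique_isFlowMeasure (hφ : T.IsFlow φ) :
    ∃! μ : @Measure (V → ℤ) (gradSigma V), T.IsFlowMeasure φ μ := by
  obtain ⟨o⟩ := T.isTree.connected.nonempty
  have hs : @Measurable _ _ _ (gradSigma V) (T.integrate o) :=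
    (T.measurable_integrate o).mono le_rfl (gradSigma_le V)
  have hm : ∀ x, Measurable[gradSigma V] fun h : V → ℤ => h (T.parent x) - h x := fun x =>
    (measurable_pi_apply x).comp T.measurable_incr_grad
  obtain ⟨h1, h2, h3⟩ := exists_isFlowMeasure_aux (m := gradSigma V) hφ.pos _ hs
    (fun x h => h (T.parent x) - h x) hm fun d x => congrFun (T.incr_integrate o d) x
  refine ⟨@Measure.map _ _ _ (gradSigma V) (T.integrate o) (incrLaw φ), ⟨h1, h2, fun x k => ?_⟩,
    fun μ hμ => ?_⟩
  · rw [h3 x k]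
    simp [geomWeight]
  · refine @Measure.ext _ (gradSigma V) _ _ fun A hA => ?_
    rw [Measure.map_apply hs hA]
    obtain ⟨A', hA', rfl⟩ := T.measurableSet_grad_iff.1 hA
    rw [hμ.apply_preimage T hφ hA', ← Set.preimage_comp]
    have : T.incr ∘ T.integrate o = id := funext fun d => T.incr_integrate o d
    rw [this, Set.preimage_id]

end DirectedTree

/-! ### Invariance under finite modifications -/

namespace DirectedTree

variable {V : Type*} (T : DirectedTree V) {φ : V → ℝ≥0∞}

/-- The measure `μ` is preserved by the addition of `f`, as long as one stays within the monotone
functions. -/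
def InvariantUnder {m : MeasurableSpace (V → ℤ)} (μ : @Measure (V → ℤ) m) (f : V → ℤ) : Prop :=
  ∀ A, MeasurableSet[m] A →
    μ {h | h ∈ T.monotoneFunctions ∧ h + f ∈ T.monotoneFunctions ∧ h + f ∈ A} =
      μ {h | h ∈ T.monotoneFunctions ∧ h - f ∈ T.monotoneFunctions ∧ h ∈ A}

/-- Sigma-algebras between the gradient and the product sigma-algebra which are stable under
translations. -/
structure IsTranslationSigma (m : MeasurableSpace (V → ℤ)) : Prop where
  grad_le : gradSigma V ≤ m
  le_pi : m ≤ MeasurableSpace.pi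
  measurable_add : ∀ f : V → ℤ, Measurable[m, m] fun h => h + f

lemma isTranslationSigma_grad : IsTranslationSigma (gradSigma V) := by
  refine ⟨le_rfl, gradSigma_le V, fun f => ?_⟩
  refine measurable_iff_comap_le.2 ?_
  rw [MeasurableSpace.comap_iSup]
  refine iSup_le fun x => ?_
  rw [MeasurableSpace.comap_iSup]
  refine iSup_le fun y => ?_
  rw [MeasurableSpace.comap_comp]
  have : (fun h : V → ℤ => h y - h x) ∘ (fun h => h + f) =
      (fun n : ℤ => n + (f y - f x)) ∘ fun h : V → ℤ => h y - h x := by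
    funext h
    simp only [Function.comp_apply, Pi.add_apply]
    ring
  rw [this, ← MeasurableSpace.comap_comp]
  exact (MeasurableSpace.comap_mono le_top).trans (le_iSup₂_of_le x y le_rfl)

lemma isTranslationSigma_pi : IsTranslationSigma (MeasurableSpace.pi : MeasurableSpace (V → ℤ)) :=
  ⟨gradSigma_le V, le_rfl, fun f => by fun_prop⟩

section Measurability

variable [Countable V] {m : MeasurableSpace (V → ℤ)}

lemma IsTranslationSigma.measurableSet_monotone (hm : IsTranslationSigma m) :
    MeasurableSet[m] T.monotoneFunctions := hm.grad_le _ T.measurableSet_monotoneFunctions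

lemma IsTranslationSigma.measurableSet_add (hm : IsTranslationSigma m) {A : Set (V → ℤ)}
    (hA : MeasurableSet[m] A) (f : V → ℤ) : MeasurableSet[m] {h | h + f ∈ A} :=
  hm.measurable_add f hA

lemma IsTranslationSigma.measurableSet_sub (hm : IsTranslationSigma m) {A : Set (V → ℤ)}
    (hA : MeasurableSet[m] A) (f : V → ℤ) : MeasurableSet[m] {h | h - f ∈ A} := by
  simp only [sub_eq_add_neg]
  exact hm.measurable_add (-f) hA

end Measurability

lemma sup_mem_monotoneFunctions {g h : V → ℤ} (hg : g ∈ T.monotoneFunctions)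
    (hh : h ∈ T.monotoneFunctions) : g ⊔ h ∈ T.monotoneFunctions := by
  intro x
  have h1 := hg x
  have h2 := hh x
  simp only [Pi.sup_apply]
  omega

lemma monotone_ancestors {h : V → ℤ} (hh : h ∈ T.monotoneFunctions) (x : V) :
    Monotone fun n : ℕ => h (T.parent^[n] x) := by
  refine monotone_nat_of_le_succ fun n => ?_
  have := hh (T.parent^[n] x)
  rw [← Function.iterate_succ_apply' T.parent] at this
  exact sub_nonneg.1 this

lemma exists_iterate_parent_notMem (Λ : Finset V) (x : V) : ∃ n, T.parent^[n] x ∉ Λ := by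
  by_contra! h
  have : Set.Infinite (Set.range fun n : ℕ => T.parent^[n] x) :=
    Set.infinite_range_of_injective (T.parent_iterate_injective x)
  exact this (Λ.finite_toSet.subset (by rintro _ ⟨n, rfl⟩; exact h n))

/-- Following chosen children never returns to a vertex, since that would close a directed cycle;
the infinite line must leave `Λ`. -/
lemma exists_descendant_notMem (Λ : Finset V) (x : V) : ∃ n, ∃ y ∉ Λ, T.parent^[n] y = x := by
  choose c hc using T.exists_child
  have hpc : ∀ n z, T.parent^[n] (c^[n] z) = z := fun n =>
    Function.LeftInverse.iterate hc n
  have hinj : Function.Injective fun n : ℕ => c^[n] x := by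
    have key : ∀ a b : ℕ, a < b → c^[a] x ≠ c^[b] x := by
      intro a b hab h
      have h2 : T.parent^[b] (c^[a] x) = x := by rw [h, hpc]
      obtain ⟨k, rfl⟩ := Nat.exists_eq_add_of_lt hab
      rw [show a + k + 1 = (k + 1) + a by omega, Function.iterate_add_apply, hpc] at h2
      exact T.parent_iterate_ne x (by omega) h2
    intro a b h
    rcases lt_trichotomy a b with hab | hab | hab
    · exact absurd h (key a b hab)
    · exact hab
    · exact absurd h.symm (key b a hab)
  by_contra! h
  have : Set.Infinite (Set.range fun n : ℕ => c^[n] x) := Set.infinite_range_of_injective hinj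
  refine this (Λ.finite_toSet.subset ?_)
  rintro _ ⟨n, rfl⟩
  by_contra hn
  exact h n _ hn (hpc n x)

section Invariance

variable [Countable V]

lemma IsFlowMeasure.invariantUnder_single [DecidableEq V] (hφ : T.IsFlow φ)
    {μ : @Measure (V → ℤ) (gradSigma V)} (hμ : T.IsFlowMeasure φ μ) (v : V) :
    T.InvariantUnder μ (Pi.single v 1) := by
  intro A hA
  obtain ⟨A, hA', rfl⟩ := T.measurableSet_grad_iff.1 hA
  set δ := T.incr (Pi.single v 1) with hδ
  have hv : δ v = -1 := by simp [hδ, incr, T.parent_ne]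
  have hchild : ∀ y, T.parent y = v → δ y = 1 := by
    rintro y rfl
    simp [hδ, incr, (T.parent_ne y).symm]
  have hpos : MeasurableSet {d : V → ℤ | ∀ x, 0 ≤ d x} := by
    simp only [Set.ofPred_forall]
    exact MeasurableSet.iInter fun x => measurableSet_le measurable_const (measurable_pi_apply x)
  set B : Set (V → ℤ) := {d | ∀ x, 0 ≤ d x} ∩ ((fun d => d - δ) ⁻¹' {d | ∀ x, 0 ≤ d x} ∩ A) with hB
  have hBm : MeasurableSet B :=
    hpos.inter ((hpos.preimage (by fun_prop)).inter hA')
  have hincr_sub : ∀ h : V → ℤ, T.incr (h - Pi.single v 1) = T.incr h - δ := by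
    intro h
    rw [eq_sub_iff_add_eq, hδ, ← incr_add, sub_add_cancel]
  have h1 : {h | h ∈ T.monotoneFunctions ∧ h + Pi.single v 1 ∈ T.monotoneFunctions ∧
      h + Pi.single v 1 ∈ T.incr ⁻¹' A} = T.incr ⁻¹' ((fun d => d + δ) ⁻¹' B ∩ {d | 1 ≤ d v}) := by
    ext h
    simp only [Set.mem_ofPred_eq, mem_monotoneFunctions, Set.mem_preimage, incr_add, ← hδ, hB,
      Set.mem_inter_iff, add_sub_cancel_right]
    refine ⟨fun ⟨a, b, c⟩ => ⟨⟨b, a, c⟩, ?_⟩, fun ⟨⟨b, a, c⟩, _⟩ => ⟨a, b, c⟩⟩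
    have := b v
    rw [Pi.add_apply, hv] at this
    omega
  have h2 : {h | h ∈ T.monotoneFunctions ∧ h - Pi.single v 1 ∈ T.monotoneFunctions ∧
      h ∈ T.incr ⁻¹' A} = T.incr ⁻¹' (B ∩ {d | ∀ y, T.parent y = v → 1 ≤ d y}) := by
    ext h
    simp only [Set.mem_ofPred_eq, mem_monotoneFunctions, Set.mem_preimage, hincr_sub, hB,
      Set.mem_inter_iff]
    refine ⟨fun ⟨a, b, c⟩ => ⟨⟨a, b, c⟩, fun y hy => ?_⟩, fun ⟨⟨a, b, c⟩, _⟩ => ⟨a, b, c⟩⟩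
    have := b y
    rw [Pi.sub_apply, hchild y hy] at this
    omega
  have hm1 : MeasurableSet {d : V → ℤ | 1 ≤ d v} :=
    measurableSet_le measurable_const (measurable_pi_apply v)
  have hm2 : MeasurableSet {d : V → ℤ | ∀ y, T.parent y = v → 1 ≤ d y} :=
    measurableSet_one_le {y | T.parent y = v}
  have hpre : MeasurableSet ((fun d : V → ℤ => d + δ) ⁻¹' B) := hBm.preimage (by fun_prop)
  rw [h1, h2, hμ.apply_preimage T hφ (hpre.inter hm1), hμ.apply_preimage T hφ (hBm.inter hm2),
    ← Measure.restrict_apply hpre, ← Measure.restrict_apply hBm,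
    ← Measure.map_apply (by fun_prop) hBm, T.incrLaw_map_raise hφ]

variable {m : MeasurableSpace (V → ℤ)} {μ : @Measure (V → ℤ) m}

/-- Induction on the total height added: unit raises are performed in an order for which every
intermediate function stays monotone. -/
lemma InvariantUnder.natCast [DecidableEq V] (hm : IsTranslationSigma m)
    (hμ : ∀ v, T.InvariantUnder μ (Pi.single v 1)) (f : V →₀ ℕ) :
    T.InvariantUnder μ (fun x => (f x : ℤ)) := by
  induction hn : f.degree generalizing f with
  | zero =>
    intro A _
    obtain rfl : f = 0 := (Finsupp.degree_eq_zero_iff f).1 hn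
    have h0 : (fun x => (((0 : V →₀ ℕ) x : ℕ) : ℤ)) = (0 : V → ℤ) := by funext x; simp
    rw [h0]
    simp
  | succ n ih =>
    intro A hA
    -- Going up from a vertex of the support, `v` is the last one before `f` first vanishes. Its
    -- parent is not raised at all, so `v` can be raised first.
    obtain ⟨v, hv, hpv⟩ : ∃ v, f v ≠ 0 ∧ f (T.parent v) = 0 := by
      obtain ⟨v₀, hv₀⟩ : ∃ v₀, f v₀ ≠ 0 := by
        by_contra! h
        obtain rfl : f = 0 := Finsupp.ext h
        simp at hn
      have hex : ∃ n, f (T.parent^[n] v₀) = 0 := by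
        obtain ⟨n, hn⟩ := T.exists_iterate_parent_notMem f.support v₀
        exact ⟨n, by simpa using hn⟩
      have hspec := Nat.find_spec hex
      rcases hk : Nat.find hex with _ | k
      · rw [hk] at hspec
        exact absurd hspec hv₀
      · rw [hk, Function.iterate_succ_apply'] at hspec
        exact ⟨_, Nat.find_min hex (m := k) (by omega), hspec⟩
    set f' : V →₀ ℕ := f - Finsupp.single v 1 with hf'
    have hff' : f = f' + Finsupp.single v 1 := by
      ext x
      by_cases hx : x = v
      · subst hx
        simp only [hf', Finsupp.add_apply, Finsupp.tsub_apply, Finsupp.single_eq_same]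
        omega
      · simp [hf', hx]
    have hdeg : f'.degree = n := by
      have := congrArg Finsupp.degree hff'
      rw [hn, map_add, Finsupp.degree_single] at this
      omega
    have hcast : (fun x => (f x : ℤ)) = Pi.single v 1 + fun x => (f' x : ℤ) := by
      funext x
      rw [hff']
      by_cases hx : x = v
      · subst hx; simp [add_comm]
      · simp [hx]
    set g : V → ℤ := fun x => (f' x : ℤ) with hg
    have hmid : ∀ h : V → ℤ, h ∈ T.monotoneFunctions →
        h + Pi.single v 1 + g ∈ T.monotoneFunctions →
        h + Pi.single v 1 ∈ T.monotoneFunctions := by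
      intro h h1 h2 x
      have a := h1 x
      have b := h2 x
      have hgv : g (T.parent v) = 0 := by
        simp only [hg, hf', Finsupp.tsub_apply, hpv, zero_tsub, Nat.cast_zero]
      by_cases hx : x = v
      · subst hx
        have hgx : 0 ≤ g x := by simp [hg]
        simp only [Pi.add_apply, Pi.single_eq_same, Pi.single_eq_of_ne (T.parent_ne x), hgv]
          at a b ⊢
        omega
      · have h0 : 0 ≤ (Pi.single v 1 : V → ℤ) (T.parent x) := by
          by_cases h : T.parent x = v
          · simp [h]
          · simp [h]
        simp only [Pi.add_apply, Pi.single_eq_of_ne hx] at a ⊢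
        omega
    have hM := hm.measurableSet_monotone T
    have e1 : {h | h ∈ T.monotoneFunctions ∧ h + (fun x => (f x : ℤ)) ∈ T.monotoneFunctions ∧
        h + (fun x => (f x : ℤ)) ∈ A} =
        {h | h ∈ T.monotoneFunctions ∧ h + Pi.single v 1 ∈ T.monotoneFunctions ∧
          h + Pi.single v 1 ∈ {k | k + g ∈ T.monotoneFunctions ∩ A}} := by
      ext h
      simp only [hcast, Set.mem_ofPred_eq, Set.mem_inter_iff, ← add_assoc]
      exact ⟨fun ⟨a, b, c⟩ => ⟨a, hmid h a b, b, c⟩, fun ⟨a, _, b, c⟩ => ⟨a, b, c⟩⟩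
    have e2 : {h | h ∈ T.monotoneFunctions ∧ h - Pi.single v 1 ∈ T.monotoneFunctions ∧
          h ∈ {k | k + g ∈ T.monotoneFunctions ∩ A}} =
        {h | h ∈ T.monotoneFunctions ∧ h + g ∈ T.monotoneFunctions ∧
          h + g ∈ A ∩ {k | k - (g + Pi.single v 1) ∈ T.monotoneFunctions}} := by
      ext h
      have : h + g - (g + Pi.single v 1) = h - Pi.single v 1 := by abel
      simp only [Set.mem_ofPred_eq, Set.mem_inter_iff, this]
      tauto
    have e3 : {h | h ∈ T.monotoneFunctions ∧ h - g ∈ T.monotoneFunctions ∧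
          h ∈ A ∩ {k | k - (g + Pi.single v 1) ∈ T.monotoneFunctions}} =
        {h | h ∈ T.monotoneFunctions ∧ h - (fun x => (f x : ℤ)) ∈ T.monotoneFunctions ∧
          h ∈ A} := by
      ext h
      simp only [hcast, Set.mem_ofPred_eq, Set.mem_inter_iff, add_comm (Pi.single v 1) g]
      refine ⟨fun ⟨a, _, c, d⟩ => ⟨a, d, c⟩, fun ⟨a, b, c⟩ => ⟨a, ?_, c, b⟩⟩
      have := hmid (h - (g + Pi.single v 1)) b (by
        convert a using 1; abel)
      convert this using 1; abel
    rw [e1, hμ v _ (hm.measurableSet_add (hM.inter hA) g), e2,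
      ih f' hdeg _ (hA.inter (hm.measurableSet_sub hM _)), e3]

/-- The modification splits as `p - q` with `p`, `q` its positive and negative parts: raise by `p`,
then undo a raise by `q`. -/
lemma InvariantUnder.finsupp [DecidableEq V] (hm : IsTranslationSigma m)
    (hμ : ∀ v, T.InvariantUnder μ (Pi.single v 1)) (f : V →₀ ℤ) : T.InvariantUnder μ f := by
  intro A hA
  set p : V → ℤ := fun x => ((f.mapRange Int.toNat rfl x : ℕ) : ℤ) with hp
  set q : V → ℤ := fun x => (((-f).mapRange Int.toNat rfl x : ℕ) : ℤ) with hq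
  have hpI : T.InvariantUnder μ p := InvariantUnder.natCast T hm hμ _
  have hqI : T.InvariantUnder μ q := InvariantUnder.natCast T hm hμ _
  have hf : (f : V → ℤ) = p - q := by
    funext x
    simp only [hp, hq, Pi.sub_apply, Finsupp.mapRange_apply, Finsupp.neg_apply]
    omega
  -- The intermediate function `h + p` is the pointwise maximum of `h` and `h + f`, and monotone
  -- functions are stable under maxima.
  have hsup : ∀ h : V → ℤ, h ∈ T.monotoneFunctions → h + f ∈ T.monotoneFunctions →
      h + p ∈ T.monotoneFunctions := by
    intro h h1 h2
    convert T.sup_mem_monotoneFunctions h1 h2 using 1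
    funext x
    simp only [hp, Pi.add_apply, Pi.sup_apply, Finsupp.mapRange_apply]
    omega
  have hM := hm.measurableSet_monotone T
  have e1 : {h | h ∈ T.monotoneFunctions ∧ h + f ∈ T.monotoneFunctions ∧ h + f ∈ A} =
      {h | h ∈ T.monotoneFunctions ∧ h + p ∈ T.monotoneFunctions ∧
        h + p ∈ {k | k - q ∈ T.monotoneFunctions ∩ A}} := by
    ext h
    have : h + p - q = h + f := by rw [hf]; abel
    simp only [Set.mem_ofPred_eq, Set.mem_inter_iff, this]
    exact ⟨fun ⟨a, b, c⟩ => ⟨a, hsup h a b, b, c⟩, fun ⟨a, _, b, c⟩ => ⟨a, b, c⟩⟩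
  have e2 : {h | h ∈ T.monotoneFunctions ∧ h - p ∈ T.monotoneFunctions ∧
        h ∈ {k | k - q ∈ T.monotoneFunctions ∩ A}} =
      {h | h ∈ T.monotoneFunctions ∧ h - q ∈ T.monotoneFunctions ∧
        h ∈ {k | k - q ∈ A ∧ k - p ∈ T.monotoneFunctions}} := by
    ext h
    simp only [Set.mem_ofPred_eq, Set.mem_inter_iff]
    tauto
  have e3 : {h | h ∈ T.monotoneFunctions ∧ h + q ∈ T.monotoneFunctions ∧
        h + q ∈ {k | k - q ∈ A ∧ k - p ∈ T.monotoneFunctions}} =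
      {h | h ∈ T.monotoneFunctions ∧ h - f ∈ T.monotoneFunctions ∧ h ∈ A} := by
    ext h
    have : h + q - p = h - f := by rw [hf]; abel
    simp only [Set.mem_ofPred_eq, this, add_sub_cancel_right]
    refine ⟨fun ⟨a, _, c, d⟩ => ⟨a, d, c⟩, fun ⟨a, b, c⟩ => ⟨a, ?_, c, b⟩⟩
    have := hsup (h - f) b (by simpa using a)
    convert this using 1
    rw [hf]; abel
  rw [e1, hpI _ (hm.measurableSet_sub (hM.inter hA) q), e2, ← e3]
  exact (hqI _ ((hm.measurableSet_sub hA q).inter (hm.measurableSet_sub hM p))).symm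

lemma InvariantUnder.map_restrict (hm : IsTranslationSigma m) {f : V → ℤ}
    (hμ : T.InvariantUnder μ f) :
    (μ.restrict {h | h ∈ T.monotoneFunctions ∧ h + f ∈ T.monotoneFunctions}).map (fun h => h + f) =
      μ.restrict {h | h ∈ T.monotoneFunctions ∧ h - f ∈ T.monotoneFunctions} := by
  refine @Measure.ext _ m _ _ fun A hA => ?_
  rw [Measure.map_apply (hm.measurable_add f) hA,
    Measure.restrict_apply (hm.measurable_add f hA), Measure.restrict_apply hA]
  convert hμ A hA using 2
  · ext h
    simp only [Set.mem_inter_iff, Set.mem_preimage, Set.mem_ofPred_eq]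
    tauto
  · ext h
    simp only [Set.mem_inter_iff, Set.mem_ofPred_eq]
    tauto

lemma IsFlowMeasure.invariantUnder (hφ : T.IsFlow φ)
    {μ : @Measure (V → ℤ) (gradSigma V)} (hμ : T.IsFlowMeasure φ μ) (f : V →₀ ℤ) :
    T.InvariantUnder μ f := by
  classical
  exact InvariantUnder.finsupp T isTranslationSigma_grad
    (fun v => hμ.invariantUnder_single T hφ v) f

lemma IsFlowMeasure.compl_monotoneFunctions (hφ : T.IsFlow φ)
    {μ : @Measure (V → ℤ) (gradSigma V)} (hμ : T.IsFlowMeasure φ μ) :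
    μ T.monotoneFunctionsᶜ = 0 := by
  have hP := isProbabilityMeasure_incrLaw hφ.pos
  have hset : T.monotoneFunctionsᶜ = T.incr ⁻¹' (⋃ x, {d | d x ∈ Set.Iio 0}) := by
    ext h
    simp [mem_monotoneFunctions]
  have hmeas : ∀ x : V, MeasurableSet {d : V → ℤ | d x ∈ Set.Iio 0} := fun x =>
    measurableSet_Iio.preimage (measurable_pi_apply x)
  rw [hset, hμ.apply_preimage T hφ (MeasurableSet.iUnion hmeas), measure_iUnion_null_iff]
  intro x
  have hprob : ∀ x, IsProbabilityMeasure (geom (φ x)) :=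
    fun x => isProbabilityMeasure_geom (hφ.pos x)
  have h1 : incrLaw φ {d | d x ∈ Set.Iio 0} = geom (φ x) (Set.Iio 0) := by
    rw [← Measure.infinitePi_map_eval (fun x => geom (φ x)) x,
      Measure.map_apply (measurable_pi_apply x) measurableSet_Iio]
    rfl
  rw [h1, geom, Measure.sum_apply _ measurableSet_Iio, ENNReal.tsum_eq_zero]
  intro n
  by_cases hn : 0 ≤ n
  · simp [hn]
  · simp [geomWeight, hn]

end Invariance

end DirectedTree

/-! ### Local Gibbs measures and the DLR equations -/

namespace DirectedTree

variable {V : Type*} (T : DirectedTree V) {φ : V → ℝ≥0∞}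

/-- Each vertex has a descendant and an ancestor outside `Λ`, whose fixed heights bound its own from
below and above. -/
lemma finite_admissible (Λ : Finset V) {b : V → ℤ} (hb : b ∈ T.monotoneFunctions) :
    {f : V →₀ ℤ | f.support ⊆ Λ ∧ b + f ∈ T.monotoneFunctions}.Finite := by
  classical
  choose n hn using T.exists_iterate_parent_notMem Λ
  choose k c hc hck using T.exists_descendant_notMem Λ
  refine (Finset.finite_toSet
    (Λ.finsupp fun x => Finset.Icc (b (c x) - b x) (b (T.parent^[n x] x) - b x))).subset ?_
  rintro f ⟨hf, hbf⟩
  have hout : ∀ y ∉ Λ, f y = 0 := fun y hy => by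
    by_contra h
    exact hy (hf (Finsupp.mem_support_iff.2 h))
  rw [Finset.mem_coe, Finset.mem_finsupp_iff]
  refine ⟨hf, fun x _ => Finset.mem_Icc.2 ⟨?_, ?_⟩⟩
  · have := T.monotone_ancestors hbf (c x) (Nat.zero_le (k x))
    simp only [Function.iterate_zero, id, hck, Pi.add_apply, hout _ (hc x)] at this
    omega
  · have := T.monotone_ancestors hbf x (Nat.zero_le (n x))
    simp only [Function.iterate_zero, id, Pi.add_apply, hout _ (hn x)] at this
    omega

open Classical in
/-- The finitely many modifications of `b` within `Λ` which lead to monotone functions. -/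
noncomputable def admissible (Λ : Finset V) (b : V → ℤ) : Finset (V →₀ ℤ) :=
  if hb : b ∈ T.monotoneFunctions then (T.finite_admissible Λ hb).toFinset else ∅

lemma mem_admissible {Λ : Finset V} {b : V → ℤ} {f : V →₀ ℤ} :
    f ∈ T.admissible Λ b ↔
      b ∈ T.monotoneFunctions ∧ f.support ⊆ Λ ∧ b + f ∈ T.monotoneFunctions := by
  unfold admissible
  split_ifs with hb <;> simp [hb]

lemma zero_mem_admissible (Λ : Finset V) {b : V → ℤ} (hb : b ∈ T.monotoneFunctions) :
    0 ∈ T.admissible Λ b := by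
  simp [mem_admissible, hb]

lemma card_admissible_ne_zero (Λ : Finset V) {b : V → ℤ} (hb : b ∈ T.monotoneFunctions) :
    (T.admissible Λ b).card ≠ 0 :=
  Finset.card_ne_zero_of_mem (T.zero_mem_admissible Λ hb)

/-- Changing the boundary function within its own class only translates the admissible set. In
particular the uniform weights agree, which is the detailed balance behind the DLR equations. -/
lemma admissible_add {Λ : Finset V} {b : V → ℤ} {f : V →₀ ℤ} (hf : f ∈ T.admissible Λ b) :
    T.admissible Λ b = (T.admissible Λ (b + f)).map (addRightEmbedding f) := by
  classical
  obtain ⟨hb, hfΛ, hbf⟩ := T.mem_admissible.1 hf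
  ext g
  simp only [Finset.mem_map, mem_admissible, hb, hbf, true_and, addRightEmbedding_apply]
  constructor
  · rintro ⟨hg, hbg⟩
    refine ⟨g - f, ⟨Finsupp.support_sub.trans (Finset.union_subset hg hfΛ), ?_⟩, by simp⟩
    convert hbg using 1
    rw [Finsupp.coe_sub]
    abel
  · rintro ⟨g, ⟨hg, hbg⟩, rfl⟩
    refine ⟨Finsupp.support_add.trans (Finset.union_subset hg hfΛ), ?_⟩
    convert hbg using 1
    rw [Finsupp.coe_add]
    abel

lemma card_admissible_add {Λ : Finset V} {b : V → ℤ} {f : V →₀ ℤ} (hf : f ∈ T.admissible Λ b) :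
    (T.admissible Λ (b + f)).card = (T.admissible Λ b).card := by
  rw [T.admissible_add hf, Finset.card_map]

lemma admissible_add_const (Λ : Finset V) (b : V → ℤ) (a : ℤ) :
    T.admissible Λ (fun x => b x + a) = T.admissible Λ b := by
  ext f
  have h : ((fun x => b x + a) + f : V → ℤ) = fun x => (b + f) x + a := by
    funext x
    simp only [Pi.add_apply]
    ring
  simp only [mem_admissible, h, mem_monotoneFunctions, incr_add_const]

variable [Countable V]

lemma measurable_admissible {m : MeasurableSpace (V → ℤ)} (hm : IsTranslationSigma m)
    (Λ : Finset V) : Measurable[m, ⊤] (T.admissible Λ) := by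
  have hM := hm.measurableSet_monotone T
  refine @measurable_to_countable' _ _ ⊤ _ m _ fun S => ?_
  have : T.admissible Λ ⁻¹' {S} = ⋂ f : V →₀ ℤ, {b | f ∈ T.admissible Λ b ↔ f ∈ S} := by
    ext b
    simp [Finset.ext_iff]
  rw [this]
  refine MeasurableSet.iInter fun f => ?_
  simp only [mem_admissible]
  have h1 : MeasurableSet[m] {b | b ∈ T.monotoneFunctions ∧ f.support ⊆ Λ ∧
      b + f ∈ T.monotoneFunctions} :=
    hM.inter ((MeasurableSet.const _).inter (hm.measurableSet_add hM f))
  exact h1.iff (MeasurableSet.const _)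

lemma localGibbs_eq (Λ : Finset V) {b : V → ℤ} (hb : b ∈ T.monotoneFunctions) :
    T.localGibbs Λ b =
      ((T.admissible Λ b).card : ℝ≥0∞)⁻¹ • ∑ f ∈ T.admissible Λ b, Measure.dirac (b + f) := by
  classical
  have hinj : Function.Injective fun f : V →₀ ℤ => b + f := fun f g hfg =>
    DFunLike.coe_injective (add_left_cancel hfg)
  have hset : {h | h ∈ T.monotoneFunctions ∧ ∀ x, x ∉ Λ → h x = b x} =
      ((T.admissible Λ b).map ⟨_, hinj⟩ : Finset (V → ℤ)) := by
    ext h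
    simp only [Set.mem_ofPred_eq, Finset.coe_map, Function.Embedding.coeFn_mk, Set.mem_image,
      Finset.mem_coe, mem_admissible, hb, true_and]
    constructor
    · rintro ⟨hh, hhb⟩
      refine ⟨Finsupp.onFinset Λ (fun x => h x - b x) fun x hx => ?_, ⟨?_, ?_⟩, ?_⟩
      · by_contra hxΛ
        exact hx (sub_eq_zero.2 (hhb x hxΛ))
      · exact Finsupp.support_onFinset_subset
      · convert hh using 1
        funext x
        simp
      · funext x
        simp
    · rintro ⟨f, ⟨hf, hbf⟩, rfl⟩
      refine ⟨hbf, fun x hx => ?_⟩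
      have : f x = 0 := by
        by_contra h
        exact hx (hf (Finsupp.mem_support_iff.2 h))
      simp [this]
  refine Measure.ext fun A hA => ?_
  rw [localGibbs, hset, uniformOn, cond_apply (Finset.measurableSet _), Measure.count_apply_finset,
    Finset.card_map, Measure.smul_apply, smul_eq_mul, Measure.finsetSum_apply]
  congr 1
  rw [show (((T.admissible Λ b).map ⟨_, hinj⟩ : Finset (V → ℤ)) : Set (V → ℤ)) ∩ A =
      (((T.admissible Λ b).filter fun f : V →₀ ℤ => b + ⇑f ∈ A).map ⟨_, hinj⟩ : Finset (V → ℤ)) by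
    ext h
    simp only [Finset.coe_map, Function.Embedding.coeFn_mk, Set.mem_inter_iff, Set.mem_image,
      Finset.mem_coe, Finset.mem_filter]
    constructor
    · rintro ⟨⟨f, hf, rfl⟩, hA⟩
      exact ⟨f, ⟨hf, hA⟩, rfl⟩
    · rintro ⟨f, ⟨hf, hA⟩, rfl⟩
      exact ⟨⟨f, hf, rfl⟩, hA⟩]
  rw [Measure.count_apply_finset, Finset.card_map, Finset.card_filter]
  push_cast
  refine Finset.sum_congr rfl fun f _ => ?_
  rw [Measure.dirac_apply' _ hA]
  by_cases h : b + ⇑f ∈ A <;> simp [h]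

lemma localGibbs_apply (Λ : Finset V) {b : V → ℤ} (hb : b ∈ T.monotoneFunctions)
    {A : Set (V → ℤ)} (hA : MeasurableSet A) :
    T.localGibbs Λ b A =
      ((T.admissible Λ b).card : ℝ≥0∞)⁻¹ * ∑ f ∈ T.admissible Λ b, A.indicator 1 (b + f) := by
  rw [T.localGibbs_eq Λ hb, Measure.smul_apply, smul_eq_mul, Measure.finsetSum_apply]
  congr 1
  exact Finset.sum_congr rfl fun f _ => Measure.dirac_apply' _ hA

/-- The probability of `A` under the local Gibbs measure, written as a sum over all finite
modifications, weighted symmetrically. -/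
lemma localGibbs_apply_tsum (Λ : Finset V) {b : V → ℤ} (hb : b ∈ T.monotoneFunctions)
    {A : Set (V → ℤ)} (hA : MeasurableSet A) :
    T.localGibbs Λ b A = ∑' f : V →₀ ℤ, {b | f ∈ T.admissible Λ b}.indicator
      (fun b => ((T.admissible Λ (b + f)).card : ℝ≥0∞)⁻¹ * A.indicator 1 (b + f)) b := by
  rw [T.localGibbs_apply Λ hb hA, tsum_eq_sum (s := T.admissible Λ b), Finset.mul_sum]
  · refine Finset.sum_congr rfl fun f hf => ?_
    rw [Set.indicator_of_mem (s := {b | f ∈ T.admissible Λ b}) hf, T.card_admissible_add hf]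
  · intro f hf
    exact Set.indicator_of_notMem (by exact hf) _

section Measures

variable {m : MeasurableSpace (V → ℤ)}

lemma measurableSet_mem_admissible (hm : IsTranslationSigma m) (Λ : Finset V) (f : V →₀ ℤ) :
    MeasurableSet[m] {b | f ∈ T.admissible Λ b} :=
  T.measurable_admissible hm Λ (MeasurableSpace.measurableSet_top (s := {S | f ∈ S}))

lemma measurable_card_admissible (hm : IsTranslationSigma m) (Λ : Finset V) :
    Measurable[m] fun b => ((T.admissible Λ b).card : ℝ≥0∞)⁻¹ :=
  Measurable.comp (g := fun S : Finset (V →₀ ℤ) => (S.card : ℝ≥0∞)⁻¹) measurable_from_top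
    (T.measurable_admissible hm Λ)

lemma measurable_localGibbs_term (hm : IsTranslationSigma m) (Λ : Finset V) (f : V →₀ ℤ)
    {A : Set (V → ℤ)} (hA : MeasurableSet[m] A) :
    Measurable[m] ({b | f ∈ T.admissible Λ b}.indicator
      (fun b => ((T.admissible Λ (b + f)).card : ℝ≥0∞)⁻¹ * A.indicator 1 (b + f))) := by
  refine Measurable.indicator ?_ (T.measurableSet_mem_admissible hm Λ f)
  exact ((T.measurable_card_admissible hm Λ).comp (hm.measurable_add f)).mul
    ((measurable_one.indicator hA).comp (hm.measurable_add f))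

/-- A measure which is invariant under finite modifications satisfies the DLR equations. -/
lemma satisfiesDLR_of_invariantUnder (hm : IsTranslationSigma m) {μ : @Measure (V → ℤ) m}
    (hμ : IsProbabilityMeasure μ) (hsupp : μ T.monotoneFunctionsᶜ = 0)
    (hinv : ∀ f : V →₀ ℤ, T.InvariantUnder μ f) : T.SatisfiesDLR μ := by
  refine ⟨hμ, hsupp, fun Λ A hA => ?_⟩
  have hae : ∀ᵐ b ∂μ, b ∈ T.monotoneFunctions := hsupp
  have hmeasAdm := T.measurableSet_mem_admissible hm Λ
  have hcard := T.measurable_card_admissible hm Λ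
  -- Substitute `b + f` for `b`: the weight is written at the endpoint, so invariance turns the sum
  -- over forward moves into one over backward moves. Summing over all `f` then absorbs the sign.
  have hswap : ∀ f : V →₀ ℤ, ∫⁻ b, {b | f ∈ T.admissible Λ b}.indicator
      (fun b => ((T.admissible Λ (b + f)).card : ℝ≥0∞)⁻¹ * A.indicator 1 (b + f)) b ∂μ =
      ∫⁻ b, {b | -f ∈ T.admissible Λ b}.indicator
        (fun b => ((T.admissible Λ b).card : ℝ≥0∞)⁻¹ * A.indicator 1 b) b ∂μ := by
    intro f
    have hG : Measurable[m] fun b => ((T.admissible Λ b).card : ℝ≥0∞)⁻¹ * A.indicator 1 b :=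
      hcard.mul (measurable_one.indicator hA)
    rw [lintegral_indicator (hmeasAdm f), lintegral_indicator (hmeasAdm (-f))]
    by_cases hf : f.support ⊆ Λ
    · have e1 : {b | f ∈ T.admissible Λ b} =
          {h | h ∈ T.monotoneFunctions ∧ h + f ∈ T.monotoneFunctions} := by
        ext b; simp [mem_admissible, hf]
      have e2 : {b | -f ∈ T.admissible Λ b} =
          {h | h ∈ T.monotoneFunctions ∧ h - f ∈ T.monotoneFunctions} := by
        ext b; simp [mem_admissible, hf, sub_eq_add_neg]
      rw [e1, e2, ← InvariantUnder.map_restrict T hm (hinv f),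
        lintegral_map hG (hm.measurable_add f)]
    · have e1 : {b | f ∈ T.admissible Λ b} = ∅ := by
        ext b; simp [mem_admissible, hf]
      have e2 : {b | -f ∈ T.admissible Λ b} = ∅ := by
        ext b; simp [mem_admissible, hf]
      rw [e1, e2]
      simp
  calc ∫⁻ b, T.localGibbs Λ b A ∂μ
      = ∫⁻ b, ∑' f : V →₀ ℤ, {b | f ∈ T.admissible Λ b}.indicator
        (fun b => ((T.admissible Λ (b + f)).card : ℝ≥0∞)⁻¹ * A.indicator 1 (b + f)) b ∂μ :=
        lintegral_congr_ae (hae.mono fun b hb => T.localGibbs_apply_tsum Λ hb (hm.le_pi _ hA))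
    _ = ∑' f : V →₀ ℤ, ∫⁻ b, {b | -f ∈ T.admissible Λ b}.indicator
        (fun b => ((T.admissible Λ b).card : ℝ≥0∞)⁻¹ * A.indicator 1 b) b ∂μ := by
        rw [lintegral_tsum fun f => (T.measurable_localGibbs_term hm Λ f hA).aemeasurable]
        exact tsum_congr hswap
    _ = ∑' f : V →₀ ℤ, ∫⁻ b, {b | f ∈ T.admissible Λ b}.indicator
        (fun b => ((T.admissible Λ b).card : ℝ≥0∞)⁻¹ * A.indicator 1 b) b ∂μ :=
        (Equiv.neg (V →₀ ℤ)).tsum_eq fun f => ∫⁻ b, {b | f ∈ T.admissible Λ b}.indicator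
          (fun b => ((T.admissible Λ b).card : ℝ≥0∞)⁻¹ * A.indicator 1 b) b ∂μ
    _ = ∫⁻ b, ∑' f : V →₀ ℤ, {b | f ∈ T.admissible Λ b}.indicator
        (fun b => ((T.admissible Λ b).card : ℝ≥0∞)⁻¹ * A.indicator 1 b) b ∂μ :=
        (lintegral_tsum fun f => ((hcard.mul (measurable_one.indicator hA)).indicator
          (hmeasAdm f)).aemeasurable).symm
    _ = ∫⁻ b, A.indicator 1 b ∂μ := by
        refine lintegral_congr_ae (hae.mono fun b hb => ?_)
        simp only []
        rw [tsum_eq_sum (s := T.admissible Λ b)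
          fun f hf => Set.indicator_of_notMem (by exact hf) _,
          Finset.sum_congr rfl fun f hf => Set.indicator_of_mem (by exact hf) _, Finset.sum_const,
          nsmul_eq_mul, ← mul_assoc, ENNReal.mul_inv_cancel
            (by exact_mod_cast T.card_admissible_ne_zero Λ hb) (by simp), one_mul]
    _ = μ A := lintegral_indicator_one hA

/-- A measure which satisfies the DLR equations is invariant under finite modifications. -/
lemma SatisfiesDLR.invariantUnder (hm : IsTranslationSigma m) {μ : @Measure (V → ℤ) m}
    (hμ : T.SatisfiesDLR μ) (f : V →₀ ℤ) : T.InvariantUnder μ f := by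
  intro A hA
  have hM := hm.measurableSet_monotone T
  have hae : ∀ᵐ b ∂μ, b ∈ T.monotoneFunctions := hμ.supported
  have h1 : MeasurableSet[m] {h | h ∈ T.monotoneFunctions ∧ h + f ∈ T.monotoneFunctions ∧
      h + f ∈ A} := hM.inter ((hm.measurableSet_add hM f).inter (hm.measurableSet_add hA f))
  have h2 : MeasurableSet[m] {h | h ∈ T.monotoneFunctions ∧ h - f ∈ T.monotoneFunctions ∧
      h ∈ A} := hM.inter ((hm.measurableSet_sub hM f).inter hA)
  -- With `Λ` the support of `f`, adding `f` is a bijection between the admissible modifications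
  -- counted by the two events.
  rw [← hμ.dlr f.support _ h1, ← hμ.dlr f.support _ h2]
  refine lintegral_congr_ae (hae.mono fun b hb => ?_)
  simp only []
  rw [T.localGibbs_apply _ hb (hm.le_pi _ h1), T.localGibbs_apply _ hb (hm.le_pi _ h2)]
  congr 1
  classical
  simp only [Set.indicator_apply, ← Finset.sum_filter]
  refine Finset.sum_nbij' (fun g => g + f) (fun g => g - f) ?_ ?_ ?_ ?_ ?_
  · intro g hg
    simp only [Finset.mem_filter, mem_admissible, Set.mem_ofPred_eq] at hg ⊢
    obtain ⟨⟨_, hgs, hbg⟩, _, hbgf, hA⟩ := hg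
    have e : b + ⇑(g + f) = b + g + f := by rw [Finsupp.coe_add, add_assoc]
    rw [e]
    refine ⟨⟨hb, ?_, hbgf⟩, hbgf, by simpa using hbg, hA⟩
    exact Finsupp.support_add.trans (Finset.union_subset hgs subset_rfl)
  · intro g hg
    simp only [Finset.mem_filter, mem_admissible, Set.mem_ofPred_eq] at hg ⊢
    obtain ⟨⟨_, hgs, hbg⟩, _, hbgf, hA⟩ := hg
    have e : b + ⇑(g - f) = b + g - f := by rw [Finsupp.coe_sub]; abel
    rw [e, sub_add_cancel]
    refine ⟨⟨hb, ?_, hbgf⟩, hbgf, hbg, hA⟩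
    exact Finsupp.support_sub.trans (Finset.union_subset hgs subset_rfl)
  · intro g _; simp
  · intro g _; simp
  · intro g _; simp

end Measures

theorem IsFlowMeasure.isGradientGibbs (hφ : T.IsFlow φ) {μ : @Measure (V → ℤ) (gradSigma V)}
    (hμ : T.IsFlowMeasure φ μ) : T.IsGradientGibbs μ :=
  T.satisfiesDLR_of_invariantUnder isTranslationSigma_grad hμ.isProb
    (hμ.compl_monotoneFunctions T hφ) (hμ.invariantUnder T hφ)

end DirectedTree

/-! ### The convergent case: offset variable and localisation -/

lemma measurableSet_eventually_atTop {Ω : Type*} {m : MeasurableSpace Ω} {s : ℕ → Set Ω}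
    (hs : ∀ n, MeasurableSet (s n)) : MeasurableSet {x | ∀ᶠ n in atTop, x ∈ s n} := by
  simp only [eventually_atTop, Set.ofPred_exists, Set.ofPred_forall]
  exact MeasurableSet.iUnion fun N => MeasurableSet.iInter fun n => MeasurableSet.iInter fun _ =>
    hs n

namespace DirectedTree

variable {V : Type*} (T : DirectedTree V) {φ : V → ℝ≥0∞}

lemma criterion_iff (x : V) :
    T.Criterion φ x ↔ ∑' n, expNeg (φ (T.parent^[n] x)) < ∞ := by
  have := tsum_range (g := fun n : ℕ => T.parent^[n] x) (fun y => expNeg (φ y))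
    (T.parent_iterate_injective x)
  rw [← this]
  rfl

/-- Ancestral lines merge, so the two sums differ by finitely many finite terms. -/
lemma criterion_of_criterion {x : V} (hx : T.Criterion φ x) (y : V) : T.Criterion φ y := by
  rw [criterion_iff] at hx ⊢
  obtain ⟨n, m, h⟩ := T.exists_common_ancestor x y
  have hsplit : ∀ (k : ℕ) (z : V), ∑' j, expNeg (φ (T.parent^[j] z)) =
      ∑ j ∈ Finset.range k, expNeg (φ (T.parent^[j] z)) +
        ∑' j, expNeg (φ (T.parent^[j] (T.parent^[k] z))) := by
    intro k z
    rw [← Summable.sum_add_tsum_nat_add' (k := k) ENNReal.summable]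
    simp only [Function.iterate_add_apply]
  rw [hsplit n, h] at hx
  rw [hsplit m]
  refine ENNReal.add_lt_top.2 ⟨?_, (ENNReal.add_lt_top.1 hx).2⟩
  exact ENNReal.sum_lt_top.2 fun j _ => (expNeg_ne_top _).lt_top

lemma tendsto_iterate_parent_cofinite (x : V) :
    Tendsto (fun n : ℕ => T.parent^[n] x) atTop cofinite := by
  rw [← Nat.cofinite_eq_atTop]
  exact (T.parent_iterate_injective x).tendsto_cofinite

lemma eventually_iterate_parent_notMem (Λ : Finset V) (x : V) :
    ∀ᶠ n in atTop, T.parent^[n] x ∉ Λ :=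
  (T.tendsto_iterate_parent_cofinite x).eventually Λ.finite_toSet.eventually_cofinite_notMem

/-- The lower limit of the heights along the ancestors of `o`, where `-∞` is replaced by `∞`. -/
noncomputable def offset (o : V) (h : V → ℤ) : EReal :=
  if liminf (fun n : ℕ => (((h (T.parent^[n] o) : ℤ) : ℝ) : EReal)) atTop = ⊥ then ⊤
  else liminf (fun n : ℕ => (((h (T.parent^[n] o) : ℤ) : ℝ) : EReal)) atTop

/-- The ancestors eventually leave any finite `Λ` and a lower limit ignores an initial segment; this
gives tail measurability. Replacing ⊥ by ⊤ preserves equivariance, as both absorb integers. -/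
lemma isHeightOffset_offset (o : V) : IsHeightOffset (T.offset o) := by
  refine ⟨?_, fun h => ?_, fun h a => ?_⟩
  · intro s hs
    refine MeasurableSpace.measurableSet_iInf.2 fun Λ => ?_
    obtain ⟨N, hN⟩ := eventually_atTop.1 (T.eventually_iterate_parent_notMem Λ o)
    have hmeas : Measurable[outsideSigma Λ] fun h : V → ℤ =>
        liminf (fun n : ℕ => (((h (T.parent^[n] o) : ℤ) : ℝ) : EReal)) atTop := by
      have : (fun h : V → ℤ =>
          liminf (fun n : ℕ => (((h (T.parent^[n] o) : ℤ) : ℝ) : EReal)) atTop) =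
          fun h => liminf (fun n : ℕ => (((h (T.parent^[n + N] o) : ℤ) : ℝ) : EReal)) atTop := by
        funext h
        rw [liminf_nat_add fun n : ℕ => (((h (T.parent^[n] o) : ℤ) : ℝ) : EReal)]
      rw [this]
      refine Measurable.liminf fun n => ?_
      have h1 : Measurable[outsideSigma Λ] fun h : V → ℤ => h (T.parent^[n + N] o) :=
        Measurable.of_comap_le
          (le_iSup₂_of_le (T.parent^[n + N] o) (hN _ (Nat.le_add_left _ _)) le_rfl)
      exact (measurable_from_top (f := fun k : ℤ => ((k : ℝ) : EReal))).comp h1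
    exact (Measurable.ite (hmeas (measurableSet_singleton ⊥)) measurable_const hmeas) hs
  · unfold offset
    split_ifs with h1
    · simp
    · exact h1
  · have hshift : liminf (fun n : ℕ => (((h (T.parent^[n] o) + a : ℤ) : ℝ) : EReal)) atTop =
        liminf (fun n : ℕ => (((h (T.parent^[n] o) : ℤ) : ℝ) : EReal)) atTop + ((a : ℝ) : EReal) := by
      have hmono : Monotone fun z : EReal => z + ((a : ℝ) : EReal) :=
        fun _ _ hzw => add_le_add_left hzw _
      have hcont : ∀ z : EReal, ContinuousAt (fun z : EReal => z + ((a : ℝ) : EReal)) z :=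
        fun z => ContinuousAt.comp (f := fun z : EReal => (z, ((a : ℝ) : EReal)))
          (g := fun p : EReal × EReal => p.1 + p.2)
          (EReal.continuousAt_add (Or.inr (EReal.coe_ne_bot _)) (Or.inr (EReal.coe_ne_top _)))
          (by fun_prop)
      rw [hmono.map_liminf_of_continuousAt _ (hcont _)]
      congr 1
      funext n
      simp
    unfold offset
    simp only [hshift]
    by_cases h1 : liminf (fun n : ℕ => (((h (T.parent^[n] o) : ℤ) : ℝ) : EReal)) atTop = ⊥
    · simp [h1]
    · rw [if_neg h1, if_neg]
      simp [EReal.add_eq_bot_iff, h1]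

/-- For monotone `h` the heights increase along the line, so the lower limit is a limit and is not
⊥. Merging of lines makes it independent of `x`. -/
lemma tendsto_offset (o x : V) {h : V → ℤ} (hh : h ∈ T.monotoneFunctions) :
    Tendsto (fun n : ℕ => (((h (T.parent^[n] x) : ℤ) : ℝ) : EReal)) atTop (𝓝 (T.offset o h)) := by
  have hmono : ∀ z : V, Monotone fun n : ℕ => (((h (T.parent^[n] z) : ℤ) : ℝ) : EReal) :=
    fun z n m hnm => EReal.coe_le_coe_iff.2 (Int.cast_le.2 (T.monotone_ancestors hh z hnm))
  have ho : Tendsto (fun n : ℕ => (((h (T.parent^[n] o) : ℤ) : ℝ) : EReal)) atTop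
      (𝓝 (T.offset o h)) := by
    have h1 := tendsto_atTop_iSup (hmono o)
    have h2 := h1.liminf_eq
    rw [offset, h2, if_neg]
    · exact h1
    · have h3 := le_iSup (fun n : ℕ => (((h (T.parent^[n] o) : ℤ) : ℝ) : EReal)) 0
      exact fun h4 => EReal.coe_ne_bot _ (le_bot_iff.1 (h3.trans_eq h4))
  obtain ⟨n, m, hnm⟩ := T.exists_common_ancestor x o
  rw [← tendsto_add_atTop_iff_nat n]
  rw [← tendsto_add_atTop_iff_nat m] at ho
  refine ho.congr fun k => ?_
  rw [Function.iterate_add_apply, Function.iterate_add_apply, hnm]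

open Classical in
/-- The eventual height along the ancestors of `o` if there is one, and else the height of `o`. -/
noncomputable def eventualHeight (o : V) (h : V → ℤ) : ℤ :=
  if hk : ∃ k : ℤ, ∀ᶠ n in atTop, h (T.parent^[n] o) = k then hk.choose else h o

lemma eventualHeight_eq (o : V) {h : V → ℤ} {k : ℤ}
    (hk : ∀ᶠ n in atTop, h (T.parent^[n] o) = k) : T.eventualHeight o h = k := by
  have hex : ∃ k : ℤ, ∀ᶠ n in atTop, h (T.parent^[n] o) = k := ⟨k, hk⟩
  rw [eventualHeight, dif_pos hex]
  obtain ⟨n, h1, h2⟩ := (hex.choose_spec.and hk).exists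
  exact h1.symm.trans h2

lemma eventualHeight_add_finsupp (o : V) {h : V → ℤ}
    (hk : ∃ k : ℤ, ∀ᶠ n in atTop, h (T.parent^[n] o) = k) (f : V →₀ ℤ) :
    T.eventualHeight o (h + f) = T.eventualHeight o h := by
  obtain ⟨k, hk⟩ := hk
  rw [T.eventualHeight_eq o hk]
  refine T.eventualHeight_eq o ?_
  filter_upwards [hk, T.eventually_iterate_parent_notMem f.support o] with n h1 h2
  simp [h1, Finsupp.notMem_support_iff.1 h2]

/-- The height function which is translated such that the eventual height is zero. -/
noncomputable def pinned (o : V) (h : V → ℤ) (x : V) : ℤ := h x + -T.eventualHeight o h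

/-- The default value `h o` of `eventualHeight` also moves with additive constants. Hence
`eventualHeight o h - h o` depends on height differences only, in all cases. -/
lemma measurable_pinned (o : V) :
    @Measurable _ _ (gradSigma V) MeasurableSpace.pi (T.pinned o) := by
  have hdiff : ∀ x y : V, Measurable[gradSigma V] fun h : V → ℤ => h y - h x := fun x y =>
    Measurable.of_comap_le (le_iSup₂_of_le x y le_rfl)
  have hset : ∀ k : ℤ, MeasurableSet[gradSigma V]
      {h : V → ℤ | ∀ᶠ n in atTop, h ∈ {h : V → ℤ | h (T.parent^[n] o) - h o = k}} := fun k =>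
    measurableSet_eventually_atTop (m := gradSigma V) fun n =>
      hdiff o (T.parent^[n] o) (measurableSet_singleton k)
  have hJ : Measurable[gradSigma V] fun h : V → ℤ => T.eventualHeight o h - h o := by
    refine @measurable_to_countable' _ _ _ _ (gradSigma V) _ fun k => ?_
    have : (fun h : V → ℤ => T.eventualHeight o h - h o) ⁻¹' {k} =
        {h : V → ℤ | ∀ᶠ n in atTop, h ∈ {h : V → ℤ | h (T.parent^[n] o) - h o = k}} ∪
        ({h : V → ℤ | k = 0} ∩ (⋃ j : ℤ, {h : V → ℤ | ∀ᶠ n in atTop,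
          h ∈ {h : V → ℤ | h (T.parent^[n] o) - h o = j}})ᶜ) := by
      ext h
      simp only [Set.mem_preimage, Set.mem_singleton_iff, Set.mem_union, Set.mem_ofPred_eq,
        Set.mem_inter_iff, Set.mem_compl_iff, Set.mem_iUnion, sub_eq_iff_eq_add]
      by_cases hk : ∃ j : ℤ, ∀ᶠ n in atTop, h (T.parent^[n] o) = j + h o
      · obtain ⟨j, hj⟩ := hk
        rw [T.eventualHeight_eq o hj]
        constructor
        · intro hjk
          left
          rwa [← hjk]
        · rintro (h1 | ⟨_, h2⟩)
          · obtain ⟨n, h3, h4⟩ := (hj.and h1).exists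
            exact h3.symm.trans h4
          · exact absurd ⟨j, hj⟩ h2
      · have hno : ¬ ∃ k : ℤ, ∀ᶠ n in atTop, h (T.parent^[n] o) = k := by
          rintro ⟨k, hk'⟩
          exact hk ⟨k - h o, by simpa using hk'⟩
        rw [eventualHeight, dif_neg hno]
        constructor
        · intro h1
          exact Or.inr ⟨by omega, hk⟩
        · rintro (h1 | ⟨h1, _⟩)
          · exact absurd ⟨k, h1⟩ hk
          · omega
    rw [this]
    exact (hset k).union ((MeasurableSet.const _).inter (MeasurableSet.iUnion fun j => hset j).compl)
  refine @measurable_pi_lambda _ _ _ (gradSigma V) _ _ fun x => ?_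
  convert (hdiff o x).sub hJ using 1
  funext h
  simp only [pinned, Pi.sub_apply]
  ring

variable [Countable V]

lemma IsFlowMeasure.one_le_incr (hφ : T.IsFlow φ) {μ : @Measure (V → ℤ) (gradSigma V)}
    (hμ : T.IsFlowMeasure φ μ) (Y : Set V) :
    μ {h | ∀ y ∈ Y, 1 ≤ T.incr h y} = expNeg (∑' y : Y, φ y) := by
  rw [← incrLaw_one_le hφ.pos Y, ← hμ.apply_preimage T hφ (measurableSet_one_le Y)]
  rfl

/-- If the criterion holds then the heights are almost surely eventually constant along the
ancestors. -/
lemma IsFlowMeasure.ae_eventually_const (hφ : T.IsFlow φ) {μ : @Measure (V → ℤ) (gradSigma V)}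
    (hμ : T.IsFlowMeasure φ μ) {o : V} (ho : T.Criterion φ o) :
    ∀ᵐ h ∂μ, h ∈ T.monotoneFunctions ∧ ∃ k : ℤ, ∀ᶠ n in atTop, h (T.parent^[n] o) = k := by
  rw [criterion_iff] at ho
  have hone : ∀ n : ℕ, μ {h | 1 ≤ T.incr h (T.parent^[n] o)} = expNeg (φ (T.parent^[n] o)) := by
    intro n
    have := hμ.one_le_incr T hφ {T.parent^[n] o}
    simpa using this
  have hmon : ∀ᵐ h ∂μ, h ∈ T.monotoneFunctions := hμ.compl_monotoneFunctions T hφ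
  -- Borel–Cantelli: the summed probabilities of positive increments are the criterion.
  have hbc := ae_eventually_notMem (μ := μ)
    (s := fun n : ℕ => {h | 1 ≤ T.incr h (T.parent^[n] o)}) (by simpa only [hone] using ho.ne)
  filter_upwards [hmon, hbc] with h h1 h2
  refine ⟨h1, ?_⟩
  obtain ⟨N, hN⟩ := eventually_atTop.1 h2
  refine ⟨h (T.parent^[N] o), eventually_atTop.2 ⟨N, fun n hn => ?_⟩⟩
  induction n, hn using Nat.le_induction with
  | base => rfl
  | succ n hn ih =>
    rw [← ih, Function.iterate_succ_apply']
    have h3 := hN n hn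
    have h4 := h1 (T.parent^[n] o)
    simp only [incr] at h3
    omega

theorem IsFlowMeasure.offset_lt_top (hφ : T.IsFlow φ) {μ : @Measure (V → ℤ) (gradSigma V)}
    (hμ : T.IsFlowMeasure φ μ) {o : V} (ho : T.Criterion φ o) : μ {h | T.offset o h < ⊤} = 1 := by
  have := hμ.isProb
  rw [← measure_univ (μ := μ)]
  refine measure_congr (eventuallyEq_univ.2 ?_)
  filter_upwards [hμ.ae_eventually_const T hφ ho] with h hh
  obtain ⟨h1, k, hk⟩ := hh
  have h2 : Tendsto (fun n : ℕ => (((h (T.parent^[n] o) : ℤ) : ℝ) : EReal)) atTop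
      (𝓝 ((k : ℝ) : EReal)) := by
    refine tendsto_const_nhds.congr' ?_
    filter_upwards [hk] with n hn
    rw [hn]
  rw [tendsto_nhds_unique (T.tendsto_offset o o h1) h2]
  exact EReal.coe_lt_top _

lemma aemeasurable_localGibbs {m : MeasurableSpace (V → ℤ)} (hm : IsTranslationSigma m)
    {μ : @Measure (V → ℤ) m} (hsupp : μ T.monotoneFunctionsᶜ = 0) (Λ : Finset V)
    {A : Set (V → ℤ)} (hA : MeasurableSet[m] A) :
    AEMeasurable (fun b => T.localGibbs Λ b A) μ := by
  have hae : ∀ᵐ b ∂μ, b ∈ T.monotoneFunctions := hsupp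
  refine ⟨fun b => ∑' f : V →₀ ℤ, {b | f ∈ T.admissible Λ b}.indicator
      (fun b => ((T.admissible Λ (b + f)).card : ℝ≥0∞)⁻¹ * A.indicator 1 (b + f)) b,
    Measurable.tsum fun f => T.measurable_localGibbs_term hm Λ f hA, ?_⟩
  exact hae.mono fun b hb => T.localGibbs_apply_tsum Λ hb (hm.le_pi _ hA)

/-- The Gibbs measure is the image of `μ` under `pinned`. Pinning commutes almost surely with finite
modifications, so its DLR equations are those of `μ` for the preimage events; on gradient events
pinning has no effect. -/
theorem IsFlowMeasure.localised (hφ : T.IsFlow φ) {μ : @Measure (V → ℤ) (gradSigma V)}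
    (hμ : T.IsFlowMeasure φ μ) {o : V} (ho : T.Criterion φ o) : T.Localised μ := by
  have hprob := hμ.isProb
  have hΦ := T.measurable_pinned o
  have hpre : ∀ A, MeasurableSet[gradSigma V] A → T.pinned o ⁻¹' A = A := fun A hA =>
    Set.ext fun h => T.add_const_mem_iff hA h _
  have hMpi : MeasurableSet T.monotoneFunctions :=
    gradSigma_le V _ T.measurableSet_monotoneFunctions
  have hsupp : (@Measure.map _ _ (gradSigma V) _ (T.pinned o) μ) T.monotoneFunctionsᶜ = 0 := by
    rw [Measure.map_apply hΦ hMpi.compl, hpre _ T.measurableSet_monotoneFunctions.compl]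
    exact hμ.compl_monotoneFunctions T hφ
  refine ⟨@Measure.map _ _ (gradSigma V) _ (T.pinned o) μ, ⟨?_, hsupp, fun Λ A hA => ?_⟩, ?_⟩
  · exact Measure.isProbabilityMeasure_map (m0 := gradSigma V) (μ := μ) hΦ.aemeasurable
  · rw [@lintegral_map' _ _ (gradSigma V) MeasurableSpace.pi μ _ _
      (T.aemeasurable_localGibbs isTranslationSigma_pi hsupp Λ hA) hΦ.aemeasurable,
      Measure.map_apply hΦ hA,
      ← (hμ.isGradientGibbs T hφ).dlr Λ _ (hΦ hA)]
    refine lintegral_congr_ae ((hμ.ae_eventually_const T hφ ho).mono fun h hh => ?_)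
    obtain ⟨h1, hk⟩ := hh
    have h2 : T.pinned o h ∈ T.monotoneFunctions :=
      (T.add_const_mem_iff T.measurableSet_monotoneFunctions h _).2 h1
    simp only []
    rw [T.localGibbs_apply Λ h1 (gradSigma_le V _ (hΦ hA)), T.localGibbs_apply Λ h2 hA]
    have h3 : T.admissible Λ (T.pinned o h) = T.admissible Λ h := T.admissible_add_const Λ h _
    rw [h3]
    congr 1
    refine Finset.sum_congr rfl fun f _ => ?_
    have h4 : T.pinned o (h + f) = T.pinned o h + f := by
      funext x
      simp only [pinned, T.eventualHeight_add_finsupp o hk, Pi.add_apply]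
      ring
    by_cases h5 : T.pinned o h + ⇑f ∈ A
    · rw [Set.indicator_of_mem h5, Set.indicator_of_mem (by rwa [Set.mem_preimage, h4])]
      rfl
    · rw [Set.indicator_of_notMem h5, Set.indicator_of_notMem (by rwa [Set.mem_preimage, h4])]
  · refine @Measure.ext _ (gradSigma V) _ _ fun A hA => ?_
    rw [trim_measurableSet_eq _ hA, Measure.map_apply hΦ (gradSigma_le V _ hA), hpre A hA]

end DirectedTree

/-! ### A second moment argument for spreading -/

section SecondMoment

variable {Ω : Type*} {m : MeasurableSpace Ω} {ν : Measure Ω} [IsProbabilityMeasure ν]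

/-- A second moment bound: if the events `E n` are nearly uncorrelated then the number of these
events which occur is nearly constant, hence nearly independent of any event `I`. -/
lemma sq_sum_measureReal_inter_sub_le {E : ℕ → Set Ω} (hE : ∀ n, MeasurableSet (E n)) {I : Set Ω}
    (hI : MeasurableSet I) {c : ℝ} (hc : 0 ≤ c) {N : ℕ}
    (hpair : ∀ n k, n ≠ k → ν.real (E n ∩ E k) ≤ c * (ν.real (E n) * ν.real (E k))) :
    (∑ n ∈ Finset.range N, ν.real (I ∩ E n) -
        (∑ n ∈ Finset.range N, ν.real (E n)) * ν.real I) ^ 2 ≤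
      ∑ n ∈ Finset.range N, ν.real (E n) +
        (c - 1) * (∑ n ∈ Finset.range N, ν.real (E n)) ^ 2 := by
  set S := ∑ n ∈ Finset.range N, ν.real (E n) with hS
  set r : Ω → ℝ := fun ω => ∑ n ∈ Finset.range N, (E n).indicator 1 ω with hr
  -- Nonnegativity of the variance of `g` gives (∫ g)² ≤ ∫ g² ≤ ∫ (r - S)², and the last integral is
  -- the variance of the counting variable `r`.
  set g : Ω → ℝ := fun ω => I.indicator 1 ω * (r ω - S) with hg
  have hind : ∀ {A : Set Ω}, MeasurableSet A → Measurable (A.indicator (1 : Ω → ℝ)) :=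
    fun hA => measurable_one.indicator hA
  have hint : ∀ {A : Set Ω}, MeasurableSet A → Integrable (A.indicator (1 : Ω → ℝ)) ν :=
    fun hA => (integrable_const (1 : ℝ)).indicator hA
  have hmul : ∀ (A B : Set Ω) (ω : Ω),
      A.indicator (1 : Ω → ℝ) ω * B.indicator 1 ω = (A ∩ B).indicator 1 ω := fun A B ω =>
    (congrFun (Set.inter_indicator_one (M₀ := ℝ) (s := A) (t := B)) ω).symm
  have hg_eq : g = fun ω => ∑ n ∈ Finset.range N, (I ∩ E n).indicator 1 ω -
      S * I.indicator 1 ω := by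
    funext ω
    simp only [hg, hr, mul_sub, Finset.mul_sum, hmul]
    ring
  have hg_int : ∫ ω, g ω ∂ν = ∑ n ∈ Finset.range N, ν.real (I ∩ E n) - S * ν.real I := by
    rw [hg_eq, integral_sub (integrable_finsetSum _ fun n _ => hint (hI.inter (hE n)))
      ((hint hI).const_mul S), integral_finsetSum _ fun n _ => hint (hI.inter (hE n)),
      integral_const_mul, integral_indicator_one hI]
    congr 1
    exact Finset.sum_congr rfl fun n _ => integral_indicator_one (hI.inter (hE n))
  have hsq_eq : (fun ω => (r ω - S) ^ 2) = fun ω =>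
      ∑ n ∈ Finset.range N, ∑ k ∈ Finset.range N, (E n ∩ E k).indicator 1 ω -
        2 * S * ∑ n ∈ Finset.range N, (E n).indicator 1 ω + S ^ 2 := by
    funext ω
    rw [sub_sq, sq (r ω)]
    simp only [hr, Finset.sum_mul_sum, hmul]
    ring
  have hi1 : Integrable (fun ω => ∑ n ∈ Finset.range N, ∑ k ∈ Finset.range N,
      (E n ∩ E k).indicator (1 : Ω → ℝ) ω) ν :=
    integrable_finsetSum _ fun n _ => integrable_finsetSum _ fun k _ => hint ((hE n).inter (hE k))
  have hi2 : Integrable (fun ω => 2 * S * ∑ n ∈ Finset.range N, (E n).indicator (1 : Ω → ℝ) ω) ν :=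
    (integrable_finsetSum _ fun n _ => hint (hE n)).const_mul _
  have hi3 : Integrable (fun ω => ∑ n ∈ Finset.range N, ∑ k ∈ Finset.range N,
      (E n ∩ E k).indicator (1 : Ω → ℝ) ω -
        2 * S * ∑ n ∈ Finset.range N, (E n).indicator (1 : Ω → ℝ) ω) ν := hi1.sub hi2
  have hsq_int : Integrable (fun ω => (r ω - S) ^ 2) ν := by
    rw [hsq_eq]
    exact hi3.add (integrable_const _)
  have hsq : ∫ ω, (r ω - S) ^ 2 ∂ν =
      ∑ n ∈ Finset.range N, ∑ k ∈ Finset.range N, ν.real (E n ∩ E k) - S ^ 2 := by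
    rw [hsq_eq, integral_add hi3 (integrable_const _), integral_sub hi1 hi2,
      integral_const_mul, integral_finsetSum _ fun n _ => hint (hE n),
      integral_finsetSum _ fun n _ => integrable_finsetSum _ fun k _ => hint ((hE n).inter (hE k))]
    simp only [integral_finsetSum _ fun k _ => hint ((hE _).inter (hE k)),
      integral_indicator_one (hE _), integral_indicator_one ((hE _).inter (hE _)), ← hS,
      integral_const, probReal_univ, one_smul]
    ring
  have hdouble : ∑ n ∈ Finset.range N, ∑ k ∈ Finset.range N, ν.real (E n ∩ E k) ≤
      S + c * S ^ 2 := by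
    have h1 : ∀ n ∈ Finset.range N, ∑ k ∈ Finset.range N, ν.real (E n ∩ E k) ≤
        ν.real (E n) + c * (ν.real (E n) * S) := by
      intro n hn
      have h2 : ∀ k ∈ Finset.range N, ν.real (E n ∩ E k) ≤
          (if n = k then ν.real (E n) else 0) + c * (ν.real (E n) * ν.real (E k)) := by
        intro k _
        split_ifs with hnk
        · subst hnk
          rw [Set.inter_self]
          have : 0 ≤ c * (ν.real (E n) * ν.real (E n)) := by positivity
          linarith
        · simpa using hpair n k hnk
      refine (Finset.sum_le_sum h2).trans_eq ?_
      rw [Finset.sum_add_distrib, Finset.sum_ite_eq, if_pos hn, ← Finset.mul_sum, ← Finset.mul_sum]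
    refine (Finset.sum_le_sum h1).trans_eq ?_
    rw [Finset.sum_add_distrib, ← Finset.mul_sum, ← Finset.sum_mul]
    ring
  have hgm : MemLp g 2 ν := by
    have hrS : MemLp (fun ω => r ω - S) 2 ν := by
      rw [memLp_two_iff_integrable_sq]
      · exact hsq_int
      · exact ((Finset.measurable_fun_sum _ fun n _ => hind (hE n)).sub_const S).aestronglyMeasurable
    have : g = I.indicator fun ω => r ω - S := by
      funext ω
      by_cases h : ω ∈ I <;> simp [hg, h]
    rw [this]
    exact hrS.indicator hI
  have hvar := variance_nonneg g ν
  rw [variance_eq_sub hgm] at hvar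
  have hle : ∫ ω, (g ^ 2) ω ∂ν ≤ ∫ ω, (r ω - S) ^ 2 ∂ν := by
    refine integral_mono hgm.integrable_sq hsq_int fun ω => ?_
    by_cases h : ω ∈ I
    · simp [hg, h]
    · simp [hg, h, sq_nonneg]
  rw [hg_int] at hvar
  linarith

/-- If `W` can be raised by one on the events `R n`, ending up in the events `L n`, and if these
families of events are nearly uncorrelated, then the law of `W` is spread out. -/
lemma measureReal_abs_lt_le_half {R L : ℕ → Set Ω} (hR : ∀ n, MeasurableSet (R n))
    (hL : ∀ n, MeasurableSet (L n)) (hRL : ∀ n, ν.real (R n) = ν.real (L n)) {c : ℝ} (hc : 0 ≤ c)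
    (hRR : ∀ n k, n ≠ k → ν.real (R n ∩ R k) ≤ c * (ν.real (R n) * ν.real (R k)))
    (hLL : ∀ n k, n ≠ k → ν.real (L n ∩ L k) ≤ c * (ν.real (L n) * ν.real (L k)))
    {N K : ℕ} {W : Ω → ℝ} (hW : Measurable W)
    (hshift : ∀ n < N, ∀ I : Set ℝ, MeasurableSet I →
      ν.real ({ω | W ω + 1 ∈ I} ∩ R n) = ν.real ({ω | W ω ∈ I} ∩ L n))
    {δ : ℝ} (hδ : 0 < δ) (hδK : 24 * K * δ ≤ 1)
    (hS : 0 < ∑ n ∈ Finset.range N, ν.real (L n))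
    (hSδ : ∑ n ∈ Finset.range N, ν.real (L n) +
      (c - 1) * (∑ n ∈ Finset.range N, ν.real (L n)) ^ 2 ≤
        (δ * ∑ n ∈ Finset.range N, ν.real (L n)) ^ 2) :
    ν.real {ω | |W ω| < K} ≤ 1 / 2 := by
  set S := ∑ n ∈ Finset.range N, ν.real (L n) with hSdef
  have hSR : ∑ n ∈ Finset.range N, ν.real (R n) = S := Finset.sum_congr rfl fun n _ => hRL n
  -- By `hshift` the sums over `R n` and `L n` coincide. The second moment bound puts this common
  -- value within `δ * S` of both `S` times the probability of `W + 1 ∈ I` and `S` times that of `W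
  -- ∈ I`.
  have hstep : ∀ I : Set ℝ, MeasurableSet I →
      |ν.real {ω | W ω + 1 ∈ I} - ν.real {ω | W ω ∈ I}| ≤ 2 * δ := by
    intro I hI
    have hm1 : MeasurableSet {ω | W ω + 1 ∈ I} := hI.preimage (hW.add_const 1)
    have hm2 : MeasurableSet {ω | W ω ∈ I} := hI.preimage hW
    have h1 := (sq_sum_measureReal_inter_sub_le (N := N) hR hm1 hc hRR).trans (hSR ▸ hSδ)
    have h2 := (sq_sum_measureReal_inter_sub_le (N := N) hL hm2 hc hLL).trans hSδ
    rw [hSR] at h1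
    rw [Finset.sum_congr rfl fun n hn => hshift n (Finset.mem_range.1 hn) I hI] at h1
    have h1' := abs_le_of_sq_le_sq' h1 (by positivity)
    have h2' := abs_le_of_sq_le_sq' h2 (by positivity)
    rw [← hSdef] at h2'
    have h3 : |S * (ν.real {ω | W ω + 1 ∈ I} - ν.real {ω | W ω ∈ I})| ≤ S * (2 * δ) := by
      rw [abs_le]
      constructor <;> nlinarith
    rw [abs_mul, abs_of_pos hS] at h3
    exact le_of_mul_le_mul_left h3 hS
  set J : ℕ → Set Ω := fun i => {ω | W ω ∈ Set.Ico (-K + i : ℝ) (K + i)} with hJ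
  have hJm : ∀ i, MeasurableSet (J i) := fun i => measurableSet_Ico.preimage hW
  have hJstep : ∀ i, ν.real (J 0) ≤ ν.real (J i) + 2 * δ * i := by
    intro i
    induction i with
    | zero => simp
    | succ i ih =>
      have h1 := (abs_le.1 (hstep _ (measurableSet_Ico (a := (-K + (i + 1 : ℕ) : ℝ))
        (b := (K + (i + 1 : ℕ) : ℝ))))).2
      have h2 : {ω | W ω + 1 ∈ Set.Ico (-K + (i + 1 : ℕ) : ℝ) (K + (i + 1 : ℕ))} = J i := by
        ext ω
        simp only [hJ, Set.mem_ofPred_eq, Set.mem_Ico]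
        push_cast
        constructor <;> rintro ⟨h3, h4⟩ <;> constructor <;> linarith
      rw [h2] at h1
      push_cast
      change ν.real (J i) - ν.real (J (i + 1)) ≤ 2 * δ at h1
      linarith
  -- Four disjoint translates of the window, by 0, 2K, 4K and 6K. Comparing each with `J 0` costs in
  -- total 2δ · 2K · (0 + 1 + 2 + 3) = 24Kδ ≤ 1, so four times the probability of `J 0` is at most
  -- 2.
  have hdisj : ∑ j ∈ Finset.range 4, ν.real (J (2 * K * j)) ≤ 1 := by
    rw [← measureReal_biUnion_finset ?_ fun j _ => hJm _]
    · exact measureReal_le_one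
    · intro a _ b _ hab
      refine Set.disjoint_left.2 fun ω h1 h2 => hab ?_
      simp only [hJ, Set.mem_ofPred_eq, Set.mem_Ico] at h1 h2
      obtain ⟨h1, h1'⟩ := h1
      obtain ⟨h2, h2'⟩ := h2
      push_cast at h1 h1' h2 h2'
      rcases lt_trichotomy a b with h | h | h
      · have : (a : ℝ) + 1 ≤ b := by exact_mod_cast h
        nlinarith [Nat.cast_nonneg (α := ℝ) K]
      · exact h
      · have : (b : ℝ) + 1 ≤ a := by exact_mod_cast h
        nlinarith [Nat.cast_nonneg (α := ℝ) K]
  have hsub : ν.real {ω | |W ω| < K} ≤ ν.real (J 0) := by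
    refine measureReal_mono fun ω hω => ?_
    have := abs_lt.1 (show |W ω| < K from hω)
    simp only [hJ, Set.mem_ofPred_eq, Set.mem_Ico, Nat.cast_zero, add_zero]
    exact ⟨this.1.le, this.2⟩
  have h0 := hJstep (2 * K * 0)
  have h1 := hJstep (2 * K * 1)
  have h2 := hJstep (2 * K * 2)
  have h3 := hJstep (2 * K * 3)
  simp only [Finset.sum_range_succ, Finset.sum_range_zero, zero_add] at hdisj
  push_cast at h0 h1 h2 h3
  nlinarith

end SecondMoment

/-! ### Blocks with almost disjoint inflow -/

namespace DirectedTree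

variable {V : Type*} (T : DirectedTree V) {φ : V → ℝ≥0∞}

lemma IsFlow.le_parent (hφ : T.IsFlow φ) (x : V) : φ x ≤ φ (T.parent x) := by
  rw [hφ.conservation (T.parent x)]
  exact ENNReal.le_tsum (f := fun y : {y // T.parent y = T.parent x} => φ y) ⟨x, rfl⟩

lemma IsFlow.le_iterate_parent (hφ : T.IsFlow φ) (x : V) (n : ℕ) : φ x ≤ φ (T.parent^[n] x) := by
  induction n with
  | zero => rfl
  | succ n ih =>
    rw [Function.iterate_succ_apply']
    exact ih.trans (hφ.le_parent T _)

/-- If the criterion fails then the flow is finite along the ancestors. -/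
lemma IsFlow.ne_top_of_not_criterion (hφ : T.IsFlow φ) {o : V} (ho : ¬ T.Criterion φ o) (n : ℕ) :
    φ (T.parent^[n] o) ≠ ∞ := by
  intro hn
  refine ho (T.criterion_of_criterion (x := T.parent^[n] o) ?_ o)
  rw [criterion_iff]
  have : ∀ k : ℕ, expNeg (φ (T.parent^[k] (T.parent^[n] o))) = 0 := by
    intro k
    have h := hφ.le_iterate_parent T (T.parent^[n] o) k
    rw [hn, top_le_iff] at h
    rw [h, expNeg_top]
  simp [this]

/-- The vertices just below a set of vertices. -/
def lowerBoundary (B : Finset V) : Set V := {y | y ∉ B ∧ T.parent y ∈ B}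

/-- The flow into a finite set of vertices with a single outgoing edge. -/
lemma IsFlow.tsum_lowerBoundary (hφ : T.IsFlow φ) {B : Finset V} {t : V} (ht : t ∈ B)
    (hpt : T.parent t ∉ B) (hB : ∀ v ∈ B, v ≠ t → T.parent v ∈ B) (hfin : ∀ v ∈ B, φ v ≠ ∞) :
    ∑' y : T.lowerBoundary B, φ y = φ t := by
  classical
  -- Sum conservation over `B`: every edge inside `B` occurs on both sides and cancels by
  -- finiteness, leaving the edges from the lower boundary and the edge above `t`.
  have h1 : ∑ v ∈ B, φ v = ∑' y, if T.parent y ∈ B then φ y else 0 := by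
    have h2 : ∀ v, φ v = ∑' y, if T.parent y = v then φ y else 0 := by
      intro v
      rw [hφ.conservation v]
      exact (tsum_subtype {y | T.parent y = v} φ).trans
        (tsum_congr fun y => by simp [Set.indicator_apply])
    rw [Finset.sum_congr rfl fun v _ => h2 v, ← Summable.tsum_finsetSum fun _ _ => ENNReal.summable]
    exact tsum_congr fun y => by rw [Finset.sum_ite_eq]
  have h3 : ∀ y, (if T.parent y ∈ B then φ y else 0) =
      (T.lowerBoundary B).indicator φ y + if y ∈ B.erase t then φ y else 0 := by
    intro y
    by_cases hy : y ∈ B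
    · by_cases hyt : y = t
      · subst hyt
        simp [lowerBoundary, hpt, ht]
      · simp [lowerBoundary, hy, hyt, hB y hy hyt]
    · simp [lowerBoundary, Set.indicator_apply, hy]
  have h4 : ∑' y, (if y ∈ B.erase t then φ y else 0) = ∑ y ∈ B.erase t, φ y := by
    rw [tsum_eq_sum (s := B.erase t) fun y hy => if_neg hy]
    exact Finset.sum_congr rfl fun y hy => if_pos hy
  rw [tsum_congr h3, ENNReal.tsum_add, h4, ← tsum_subtype, ← Finset.add_sum_erase _ _ ht] at h1
  refine ((ENNReal.add_left_inj ?_).1 h1).symm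
  exact ENNReal.sum_ne_top.2 fun v hv => hfin v (Finset.mem_of_mem_erase hv)

/-- There are finite sets of vertices with tops at the successive ancestors of `o` such that there
is almost no flow into two of them. -/
lemma IsFlow.exists_blocks (hφ : T.IsFlow φ) {o : V} (hfin : ∀ n, φ (T.parent^[n] o) ≠ ∞)
    {ε : ℝ≥0∞} (hε : 0 < ε) :
    ∃ B : ℕ → Finset V, (∀ n, o ∈ B n) ∧ (∀ n, T.parent^[n] o ∈ B n) ∧
      (∀ n, T.parent^[n + 1] o ∉ B n) ∧
      (∀ n, ∀ v ∈ B n, v ≠ T.parent^[n] o → T.parent v ∈ B n) ∧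
      (∀ n, ∑' y : T.lowerBoundary (B n), φ y = φ (T.parent^[n] o)) ∧
      ∀ k n, k < n →
        ∑' y : (T.lowerBoundary (B k) ∩ T.lowerBoundary (B n) : Set V), φ y ≤ ε := by
  classical
  -- `G` is a finite part of the lower boundary that carries all of a finite inflow up to `ε`.
  have hG : ∀ B : Finset V, ∃ G : Finset V, (G : Set V) ⊆ T.lowerBoundary B ∧
      (∑' y : T.lowerBoundary B, φ y ≠ ∞ →
        ∑' y : (T.lowerBoundary B \ G : Set V), φ y ≤ ε) := by
    intro B
    by_cases hB : ∑' y : T.lowerBoundary B, φ y = ∞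
    · exact ⟨∅, by simp, fun h => absurd hB h⟩
    · rw [tsum_subtype] at hB
      obtain ⟨s, hs⟩ := ((ENNReal.tendsto_tsum_compl_atTop_zero hB).eventually
        (ge_mem_nhds hε)).exists
      refine ⟨s.filter fun y => y ∈ T.lowerBoundary B, fun y hy => (Finset.mem_filter.1 hy).2,
        fun _ => le_trans (le_of_eq ?_) hs⟩
      rw [tsum_subtype, show (∑' b : {x // x ∉ s}, (T.lowerBoundary B).indicator φ b) =
        ∑' b, ({x | x ∉ s} : Set V).indicator ((T.lowerBoundary B).indicator φ) b from
        tsum_subtype {x | x ∉ s} _]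
      refine tsum_congr fun y => ?_
      by_cases h1 : y ∈ s <;> by_cases h2 : y ∈ T.lowerBoundary B <;> simp [h1, h2]
  -- Each block swallows, besides the next ancestor, the essential part `G` of the boundary of its
  -- predecessor.
  choose G hGsub hGsum using hG
  let B : ℕ → Finset V := fun n => Nat.rec {o}
    (fun n B => insert (T.parent^[n + 1] o) (B ∪ G B)) n
  have hB0 : B 0 = {o} := rfl
  have hBs : ∀ n, B (n + 1) = insert (T.parent^[n + 1] o) (B n ∪ G (B n)) := fun n => rfl
  have htop : ∀ n, T.parent^[n] o ∈ B n := by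
    intro n
    cases n with
    | zero => simp [hB0]
    | succ n => rw [hBs]; exact Finset.mem_insert_self _ _
  have hsub : ∀ n, B n ⊆ B (n + 1) := fun n => by
    rw [hBs]
    exact Finset.subset_union_left.trans (Finset.subset_insert _ _)
  have hmono : Monotone B := monotone_nat_of_le_succ hsub
  have hin : ∀ n, ∀ v ∈ B n, v ≠ T.parent^[n] o → T.parent v ∈ B n := by
    intro n
    induction n with
    | zero =>
      intro v hv hne
      exact absurd (by simpa [hB0] using hv) hne
    | succ n ih =>
      intro v hv hne
      rw [hBs, Finset.mem_insert, Finset.mem_union] at hv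
      rcases hv with hv | hv | hv
      · exact absurd hv hne
      · by_cases hvn : v = T.parent^[n] o
        · rw [hvn, ← Function.iterate_succ_apply' T.parent]
          exact htop (n + 1)
        · exact hsub n (ih v hv hvn)
      · exact hsub n (hGsub _ hv).2
  have hdesc : ∀ n, ∀ v ∈ B n, ∃ k, T.parent^[k] v = T.parent^[n] o := by
    intro n
    induction n with
    | zero =>
      intro v hv
      exact ⟨0, by simpa [hB0] using hv⟩
    | succ n ih =>
      intro v hv
      rw [hBs, Finset.mem_insert, Finset.mem_union] at hv
      rcases hv with hv | hv | hv
      · exact ⟨0, hv⟩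
      · obtain ⟨k, hk⟩ := ih v hv
        exact ⟨k + 1, by rw [Function.iterate_succ_apply', hk, Function.iterate_succ_apply']⟩
      · obtain ⟨k, hk⟩ := ih _ (hGsub _ hv).2
        exact ⟨k + 1 + 1, by
          rw [Function.iterate_succ_apply', Function.iterate_succ_apply, hk,
            Function.iterate_succ_apply']⟩
  have hout : ∀ n, T.parent^[n + 1] o ∉ B n := by
    intro n hn
    obtain ⟨k, hk⟩ := hdesc n _ hn
    rw [← Function.iterate_add_apply] at hk
    have := T.parent_iterate_injective o hk
    omega
  have hflow : ∀ n, ∑' y : T.lowerBoundary (B n), φ y = φ (T.parent^[n] o) := by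
    intro n
    refine hφ.tsum_lowerBoundary T (htop n) ?_ (hin n) fun v hv => ?_
    · rw [← Function.iterate_succ_apply' T.parent]
      exact hout n
    · obtain ⟨k, hk⟩ := hdesc n v hv
      exact ne_top_of_le_ne_top (hfin n) (hk ▸ hφ.le_iterate_parent T v k)
  refine ⟨B, fun n => hmono (Nat.zero_le n) (by simp [hB0]), htop, hout, hin, hflow,
    fun k n hkn => ?_⟩
  refine le_trans ?_ (hGsum (B k) (by rw [hflow]; exact hfin k))
  -- A boundary vertex of the later block lies outside it, hence outside the part `G (B k)` that it
  -- contains.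
  refine ENNReal.tsum_mono_subtype φ fun y hy => ⟨hy.1, fun hyG => hy.2.1 ?_⟩
  refine hmono (show k + 1 ≤ n from hkn) ?_
  rw [hBs]
  exact Finset.mem_insert_of_mem (Finset.mem_union_right _ hyG)

/-- The function which raises the heights on `B` by one. -/
noncomputable def raise (B : Finset V) : V →₀ ℤ := Finsupp.indicator B fun _ _ => 1

open Classical in
lemma raise_apply (B : Finset V) (x : V) : raise B x = if x ∈ B then 1 else 0 := by
  simp [raise, Finsupp.indicator_apply]

lemma support_raise_subset (B : Finset V) : (raise B).support ⊆ B :=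
  Finsupp.support_indicator_subset _ _

/-- The edge above `t` is the only one leaving the block upwards, hence the only one whose increment
drops. -/
lemma add_raise_mem_iff {B : Finset V} {t : V} (ht : t ∈ B) (hpt : T.parent t ∉ B)
    (hB : ∀ v ∈ B, v ≠ t → T.parent v ∈ B) {h : V → ℤ} (hh : h ∈ T.monotoneFunctions) :
    h + raise B ∈ T.monotoneFunctions ↔ 1 ≤ T.incr h t := by
  simp only [mem_monotoneFunctions, incr_add, Pi.add_apply]
  constructor
  · intro h1
    have := h1 t
    simp only [incr, raise_apply, if_pos ht, if_neg hpt] at this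
    simp only [incr]
    omega
  · intro h1 x
    have h2 := hh x
    by_cases hx : x = t
    · subst hx
      simp only [incr, raise_apply, if_pos ht, if_neg hpt] at h1 ⊢
      omega
    · by_cases hxB : x ∈ B
      · simp only [incr, raise_apply, if_pos hxB, if_pos (hB x hxB hx)] at h2 ⊢
        omega
      · simp only [incr, raise_apply, if_neg hxB] at h2 ⊢
        split_ifs <;> omega

lemma sub_raise_mem_iff {B : Finset V} {h : V → ℤ} (hh : h ∈ T.monotoneFunctions) :
    h - raise B ∈ T.monotoneFunctions ↔ ∀ y ∈ T.lowerBoundary B, 1 ≤ T.incr h y := by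
  simp only [mem_monotoneFunctions]
  constructor
  · intro h1 y hy
    have := h1 y
    simp only [incr, Pi.sub_apply, raise_apply, if_neg hy.1, if_pos hy.2] at this
    simp only [incr]
    omega
  · intro h1 x
    have h2 := hh x
    simp only [incr, Pi.sub_apply, raise_apply] at h2 ⊢
    by_cases hx : x ∈ T.lowerBoundary B
    · have := h1 x hx
      simp only [incr] at this
      rw [if_neg hx.1, if_pos hx.2]
      omega
    · by_cases hxB : x ∈ B
      · split_ifs <;> omega
      · have : T.parent x ∉ B := fun hp => hx ⟨hxB, hp⟩
        rw [if_neg hxB, if_neg this]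
        omega

end DirectedTree

lemma expNeg_ofReal {r : ℝ} (hr : 0 ≤ r) :
    expNeg (ENNReal.ofReal r) = ENNReal.ofReal (Real.exp (-r)) := by
  rw [expNeg, EReal.coe_ennreal_ofReal, max_eq_left hr, ← EReal.coe_neg, EReal.exp_coe]

/-- Almost disjoint families of increments are positive almost independently. -/
lemma expNeg_tsum_union_le {V : Type*} (φ : V → ℝ≥0∞) (Y Z : Set V) {ε : ℝ≥0∞}
    (hε : ∑' y : (Y ∩ Z : Set V), φ y ≤ ε) :
    expNeg (∑' y : (Y ∪ Z : Set V), φ y) * expNeg ε ≤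
      expNeg (∑' y : Y, φ y) * expNeg (∑' y : Z, φ y) := by
  rw [← expNeg_add, ← expNeg_add]
  refine expNeg_antitone (le_trans (le_of_eq ?_) (add_le_add_right hε _))
  rw [tsum_subtype, tsum_subtype, tsum_subtype, tsum_subtype, ← ENNReal.tsum_add,
    ← ENNReal.tsum_add]
  refine tsum_congr fun y => ?_
  by_cases h1 : y ∈ Y <;> by_cases h2 : y ∈ Z <;> simp [h1, h2]

/-! ### The divergent case: delocalisation and diverging variances -/

namespace DirectedTree

variable {V : Type*} [Countable V] (T : DirectedTree V) {φ : V → ℝ≥0∞}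

lemma measurableSet_one_le_incr (Y : Set V) :
    MeasurableSet[gradSigma V] {h | ∀ y ∈ Y, 1 ≤ T.incr h y} :=
  T.measurable_incr_grad (measurableSet_one_le Y)

/-- If the criterion fails then a function of the height function which behaves like the height of
`o` under modifications in a large finite set cannot be concentrated on a bounded set. -/
theorem exists_forall_measure_abs_lt_le_half (hφ : T.IsFlow φ) {o : V} (ho : ¬ T.Criterion φ o)
    {K : ℕ} (hK : 0 < K) :
    ∃ Λ : Finset V, ∀ {m : MeasurableSpace (V → ℤ)}, IsTranslationSigma m →
      ∀ ν : @Measure (V → ℤ) m, IsProbabilityMeasure ν → ν T.monotoneFunctionsᶜ = 0 →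
      (∀ Y : Set V, ν {h | ∀ y ∈ Y, 1 ≤ T.incr h y} = expNeg (∑' y : Y, φ y)) →
      (∀ f : V →₀ ℤ, T.InvariantUnder ν f) →
      ∀ W : (V → ℤ) → ℝ, Measurable[m] W →
      (∀ f : V →₀ ℤ, f.support ⊆ Λ → ∀ h ∈ T.monotoneFunctions, h + f ∈ T.monotoneFunctions →
        W (h + f) = W h + f o) →
      ν {h | |W h| < K} ≤ 1 / 2 := by
  classical
  have hKr : (0 : ℝ) < K := by exact_mod_cast hK
  obtain ⟨δ, hδ, hδK⟩ : ∃ δ : ℝ, 0 < δ ∧ 24 * K * δ ≤ 1 :=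
    ⟨1 / (24 * K), by positivity, by field_simp; rfl⟩
  -- The allowed variance δ²S² is shared equally: this `r` makes the correlation excess exp r - 1
  -- equal to δ²/2, and `N` below is large enough that S ≤ (δ²/2)S².
  set r : ℝ := Real.log (1 + δ ^ 2 / 2) with hr
  have hr0 : 0 < r := Real.log_pos (by linarith [show 0 < δ ^ 2 / 2 by positivity])
  have hexp : Real.exp r = 1 + δ ^ 2 / 2 := Real.exp_log (by positivity)
  obtain ⟨B, hoB, htB, hptB, hinB, hflow, hover⟩ := hφ.exists_blocks T
    (hφ.ne_top_of_not_criterion T ho) (ENNReal.ofReal_pos.2 hr0)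
  have hptB' : ∀ n, T.parent (T.parent^[n] o) ∉ B n := fun n => by
    rw [← Function.iterate_succ_apply' T.parent]
    exact hptB n
  set p : ℕ → ℝ := fun n => (expNeg (φ (T.parent^[n] o))).toReal with hp
  obtain ⟨N, hN⟩ : ∃ N, 2 / δ ^ 2 ≤ ∑ n ∈ Finset.range N, p n := by
    have hdiv : ∑' n, expNeg (φ (T.parent^[n] o)) = ∞ := by
      rw [criterion_iff, not_lt, top_le_iff] at ho
      exact ho
    have htend := ENNReal.tendsto_nat_tsum fun n => expNeg (φ (T.parent^[n] o))
    rw [hdiv] at htend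
    obtain ⟨N, hN⟩ := (htend.eventually
      (lt_mem_nhds (ENNReal.ofReal_lt_top (r := 2 / δ ^ 2)))).exists
    refine ⟨N, ?_⟩
    rw [← ENNReal.toReal_sum fun n _ => expNeg_ne_top _]
    exact (ENNReal.ofReal_le_iff_le_toReal
      (ENNReal.sum_ne_top.2 fun n _ => expNeg_ne_top _)).1 hN.le
  -- The set is fixed before the sigma-algebra, the measure and `W`, so it serves Gibbs measures as
  -- well as the gradient measure, and later every larger volume.
  refine ⟨(Finset.range N).biUnion B, fun {m} hm ν hν hsupp hpos hinv W hW hshift => ?_⟩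
  set R : ℕ → Set (V → ℤ) := fun n => {h | ∀ y ∈ ({T.parent^[n] o} : Set V), 1 ≤ T.incr h y}
    with hRdef
  set L : ℕ → Set (V → ℤ) := fun n => {h | ∀ y ∈ T.lowerBoundary (B n), 1 ≤ T.incr h y} with hLdef
  have hRm : ∀ n, MeasurableSet[m] (R n) := fun n => hm.grad_le _ (T.measurableSet_one_le_incr _)
  have hLm : ∀ n, MeasurableSet[m] (L n) := fun n => hm.grad_le _ (T.measurableSet_one_le_incr _)
  have hRp : ∀ n, ν (R n) = expNeg (φ (T.parent^[n] o)) := fun n => by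
    rw [hRdef, hpos, tsum_singleton]
  have hLp : ∀ n, ν (L n) = expNeg (φ (T.parent^[n] o)) := fun n => by
    rw [hLdef, hpos, hflow]
  have hcap : ∀ Y Z : Set V, {h | ∀ y ∈ Y, 1 ≤ T.incr h y} ∩ {h | ∀ y ∈ Z, 1 ≤ T.incr h y} =
      {h | ∀ y ∈ Y ∪ Z, 1 ≤ T.incr h y} := by
    intro Y Z
    ext h
    simp only [Set.mem_inter_iff, Set.mem_ofPred_eq, Set.mem_union, or_imp, forall_and]
  have hreal : ∀ a b d : ℝ≥0∞, b ≠ ∞ → d ≠ ∞ →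
      a * expNeg (ENNReal.ofReal r) ≤ b * d → a.toReal ≤ Real.exp r * (b.toReal * d.toReal) := by
    intro a b d hb hd h
    have h1 := ENNReal.toReal_mono (ENNReal.mul_ne_top hb hd) h
    rw [ENNReal.toReal_mul, ENNReal.toReal_mul, expNeg_ofReal hr0.le,
      ENNReal.toReal_ofReal (Real.exp_pos _).le, Real.exp_neg] at h1
    rw [mul_inv_le_iff₀ (Real.exp_pos r)] at h1
    linarith
  have hRR : ∀ n k, n ≠ k → ν.real (R n ∩ R k) ≤ Real.exp r * (ν.real (R n) * ν.real (R k)) := by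
    intro n k hnk
    refine hreal _ _ _ (measure_ne_top _ _) (measure_ne_top _ _) ?_
    rw [hRdef, hcap, hpos, hpos, hpos]
    refine expNeg_tsum_union_le φ _ _ ?_
    rw [Set.singleton_inter_eq_empty.2
      (by simpa using (T.parent_iterate_injective o).ne hnk)]
    simp
  have hLL : ∀ n k, n ≠ k → ν.real (L n ∩ L k) ≤ Real.exp r * (ν.real (L n) * ν.real (L k)) := by
    intro n k hnk
    refine hreal _ _ _ (measure_ne_top _ _) (measure_ne_top _ _) ?_
    rw [hLdef, hcap, hpos, hpos, hpos]
    refine expNeg_tsum_union_le φ _ _ ?_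
    rcases lt_or_gt_of_ne hnk with h | h
    · exact hover n k h
    · rw [Set.inter_comm]
      exact hover k n h
  have hmon : ∀ᵐ h ∂ν, h ∈ T.monotoneFunctions := hsupp
  -- Invariance under raising `B n`: since `o` lies in the block, `W` increases by exactly one as `R
  -- n` is carried to `L n`.
  have hmove : ∀ n < N, ∀ I : Set ℝ, MeasurableSet I →
      ν.real ({h | W h + 1 ∈ I} ∩ R n) = ν.real ({h | W h ∈ I} ∩ L n) := by
    intro n hn I hI
    have h1 := hinv (raise (B n)) _ (hW hI)
    have hsuppB : (raise (B n)).support ⊆ (Finset.range N).biUnion B :=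
      (support_raise_subset _).trans
        (Finset.subset_biUnion_of_mem B (Finset.mem_range.2 hn))
    refine congrArg ENNReal.toReal ?_
    refine (measure_congr ?_).trans (h1.trans (measure_congr ?_))
    · filter_upwards [hmon] with h hh
      refine propext ?_
      change (W h + 1 ∈ I ∧ h ∈ R n) ↔ (h ∈ T.monotoneFunctions ∧
        h + raise (B n) ∈ T.monotoneFunctions ∧ W (h + raise (B n)) ∈ I)
      have hRiff : h ∈ R n ↔ h + raise (B n) ∈ T.monotoneFunctions := by
        rw [T.add_raise_mem_iff (htB n) (hptB' n) (hinB n) hh]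
        simp [hRdef]
      have hWr : h + raise (B n) ∈ T.monotoneFunctions → W (h + raise (B n)) = W h + 1 := by
        intro h2
        rw [hshift _ hsuppB h hh h2, raise_apply, if_pos (hoB n), Int.cast_one]
      rw [hRiff]
      constructor
      · rintro ⟨h2, h3⟩
        exact ⟨hh, h3, by rwa [hWr h3]⟩
      · rintro ⟨_, h3, h2⟩
        exact ⟨by rwa [hWr h3] at h2, h3⟩
    · filter_upwards [hmon] with h hh
      refine propext ?_
      change (h ∈ T.monotoneFunctions ∧ h - raise (B n) ∈ T.monotoneFunctions ∧ W h ∈ I) ↔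
        (W h ∈ I ∧ h ∈ L n)
      rw [T.sub_raise_mem_iff hh]
      exact ⟨fun ⟨_, a, b⟩ => ⟨b, a⟩, fun ⟨a, b⟩ => ⟨hh, b, a⟩⟩
  have hLreal : ∀ n, ν.real (L n) = p n := fun n => congrArg ENNReal.toReal (hLp n)
  have hS0 : 0 < ∑ n ∈ Finset.range N, p n := lt_of_lt_of_le (by positivity) hN
  have hhalf : ν.real {h | |W h| < K} ≤ 1 / 2 := by
    refine measureReal_abs_lt_le_half hRm hLm (fun n => ?_) (Real.exp_pos r).le hRR hLL hW hmove hδ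
      hδK ?_ ?_
    · exact congrArg ENNReal.toReal ((hRp n).trans (hLp n).symm)
    · simpa only [hLreal] using hS0
    · simp only [hLreal, hexp]
      rw [div_le_iff₀ (by positivity)] at hN
      nlinarith [mul_le_mul_of_nonneg_left hN hS0.le]
  rw [← ENNReal.toReal_le_toReal (measure_ne_top _ _) (by simp)]
  simpa [Measure.real] using hhalf

/-- If the criterion fails then the flow measure is not localised. -/
theorem IsFlowMeasure.not_localised (hφ : T.IsFlow φ) {μ : @Measure (V → ℤ) (gradSigma V)}
    (hμ : T.IsFlowMeasure φ μ) {o : V} (ho : ¬ T.Criterion φ o) : ¬ T.Localised μ := by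
  rintro ⟨ν, hν, hνμ⟩
  have hprob : IsProbabilityMeasure ν := hν.isProb
  have hW : Measurable fun h : V → ℤ => (h o : ℝ) :=
    measurable_from_top.comp (measurable_pi_apply o)
  -- A height takes finite values, so these probabilities must tend to one as `K` grows; the uniform
  -- bound is the contradiction.
  have hbound : ∀ K : ℕ, ν {h | |(h o : ℝ)| < K} ≤ 1 / 2 := by
    intro K
    rcases Nat.eq_zero_or_pos K with rfl | hK
    · have : {h : V → ℤ | |(h o : ℝ)| < ((0 : ℕ) : ℝ)} = ∅ := by
        ext h
        simp
      rw [this]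
      simp
    · obtain ⟨Λ, hΛ⟩ := T.exists_forall_measure_abs_lt_le_half hφ ho hK
      refine hΛ isTranslationSigma_pi ν hprob hν.supported (fun Y => ?_)
        (hν.invariantUnder T isTranslationSigma_pi) _ hW ?_
      · rw [← hμ.one_le_incr T hφ Y, ← hνμ, trim_measurableSet_eq _ (T.measurableSet_one_le_incr Y)]
      · intro f _ h _ _
        simp
  have htend : Tendsto (fun K : ℕ => ν {h | |(h o : ℝ)| < K}) atTop (𝓝 (ν Set.univ)) := by
    have hU : (⋃ K : ℕ, {h : V → ℤ | |(h o : ℝ)| < K}) = Set.univ := by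
      refine Set.eq_univ_of_forall fun h => Set.mem_iUnion.2 ?_
      exact exists_nat_gt |(h o : ℝ)|
    rw [← hU]
    refine tendsto_measure_iUnion_atTop fun K M hKM h hh => ?_
    exact lt_of_lt_of_le (show |(h o : ℝ)| < K from hh) (by exact_mod_cast hKM)
  have := le_of_tendsto' htend hbound
  rw [measure_univ] at this
  exact absurd this (by
    rw [not_le, one_div]
    exact ENNReal.inv_lt_one.2 (by norm_num))

/-- The difference between the height of `x` and its mean under the local Gibbs measure. -/
noncomputable def centred (Λ : Finset V) (x : V) (h : V → ℤ) : ℝ :=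
  -(((T.admissible Λ h).card : ℝ)⁻¹ * ∑ f ∈ T.admissible Λ h, (f x : ℝ))

/-- The variable depends on `h` through its admissible set only, so it is gradient measurable
although the height itself is not. -/
lemma measurable_centred {m : MeasurableSpace (V → ℤ)} (hm : IsTranslationSigma m) (Λ : Finset V)
    (x : V) : Measurable[m] (T.centred Λ x) :=
  Measurable.comp (g := fun S : Finset (V →₀ ℤ) => -((S.card : ℝ)⁻¹ * ∑ f ∈ S, (f x : ℝ)))
    measurable_from_top (T.measurable_admissible hm Λ)

/-- The local mean is the same throughout a class, so a modification shifts the centred height by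
its value at `x`. -/
lemma centred_add {Λ : Finset V} (x : V) {h : V → ℤ} {f : V →₀ ℤ} (hf : f ∈ T.admissible Λ h) :
    T.centred Λ x (h + f) = T.centred Λ x h + f x := by
  have hc : ((T.admissible Λ h).card : ℝ) ≠ 0 := by
    exact_mod_cast Finset.card_ne_zero_of_mem hf
  have h1 : ∑ g ∈ T.admissible Λ h, (g x : ℝ) =
      ∑ g ∈ T.admissible Λ (h + f), (g x : ℝ) + (T.admissible Λ h).card * f x := by
    rw [T.admissible_add hf, Finset.sum_map, Finset.card_map]
    simp [Finset.sum_add_distrib]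
  rw [centred, centred, T.card_admissible_add hf, h1]
  field_simp
  ring

lemma centred_eq (Λ : Finset V) (x : V) {b : V → ℤ} (hb : b ∈ T.monotoneFunctions) :
    (b x : ℝ) - ∫ h, (h x : ℝ) ∂T.localGibbs Λ b = T.centred Λ x b := by
  have hc : ((T.admissible Λ b).card : ℝ) ≠ 0 := by
    exact_mod_cast T.card_admissible_ne_zero Λ hb
  have hW : Measurable fun h : V → ℤ => (h x : ℝ) :=
    measurable_from_top.comp (measurable_pi_apply x)
  rw [T.localGibbs_eq Λ hb, integral_smul_measure, integral_finsetSum_measure]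
  · simp only [integral_dirac' _ _ hW.stronglyMeasurable, ENNReal.toReal_inv,
      ENNReal.toReal_natCast, smul_eq_mul, Pi.add_apply, Int.cast_add, Finset.sum_add_distrib,
      Finset.sum_const, nsmul_eq_mul, centred]
    field_simp
    ring
  · intro f _
    exact integrable_dirac' hW.stronglyMeasurable (by simp)

/-- If the criterion fails then the averaged variances in finite volume diverge. -/
theorem IsFlowMeasure.tendsto_lintegral_evariance (hφ : T.IsFlow φ)
    {μ : @Measure (V → ℤ) (gradSigma V)} (hμ : T.IsFlowMeasure φ μ) {x : V}
    (hx : ¬ T.Criterion φ x) :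
    Tendsto (fun Λ : Finset V =>
      ∫⁻ b, evariance (fun h : V → ℤ => (h x : ℝ)) (T.localGibbs Λ b) ∂μ) atTop (𝓝 ∞) := by
  have hprob := hμ.isProb
  have hsupp := hμ.compl_monotoneFunctions T hφ
  have hmon : ∀ᵐ b ∂μ, b ∈ T.monotoneFunctions := hsupp
  refine ENNReal.tendsto_nhds_top fun n => ?_
  obtain ⟨K, hK, hKn⟩ : ∃ K : ℕ, 0 < K ∧ (n : ℝ≥0∞) < (K : ℝ≥0∞) ^ 2 * (1 / 2) := by
    refine ⟨2 * (n + 1), by omega, ?_⟩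
    have h1 : ((2 * (n + 1) : ℕ) : ℝ≥0∞) ^ 2 * (1 / 2) = ((2 * (n + 1) ^ 2 : ℕ) : ℝ≥0∞) := by
      push_cast
      rw [one_div, show ((2 : ℝ≥0∞) * (n + 1)) ^ 2 = 2 * (n + 1) ^ 2 * 2 by ring, mul_assoc,
        ENNReal.mul_inv_cancel (by norm_num) (by norm_num), mul_one]
    rw [h1]
    exact_mod_cast (by nlinarith : n < 2 * (n + 1) ^ 2)
  obtain ⟨Λ₀, hΛ₀⟩ := T.exists_forall_measure_abs_lt_le_half hφ hx hK
  filter_upwards [eventually_ge_atTop Λ₀] with Λ hΛ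
  refine hKn.trans_le ?_
  have hWm := T.measurable_centred isTranslationSigma_grad Λ x
  have hsmall : μ {h | |T.centred Λ x h| < K} ≤ 1 / 2 := by
    refine hΛ₀ isTranslationSigma_grad μ hprob hsupp (hμ.one_le_incr T hφ)
      (hμ.invariantUnder T hφ) _ hWm fun f hf h h1 h2 => ?_
    exact T.centred_add x (T.mem_admissible.2 ⟨h1, hf.trans hΛ, h2⟩)
  -- Chebyshev inside the local Gibbs measure: its variance is at least `K ^ 2` times its mass on
  -- `A`. By the DLR equations this mass averages to the measure of `A`, which is at least one half.
  set A : Set (V → ℤ) := {h | (K : ℝ) ≤ |T.centred Λ x h|} with hA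
  have hAm : MeasurableSet[gradSigma V] A :=
    hWm (measurableSet_le measurable_const measurable_abs : MeasurableSet {t : ℝ | (K : ℝ) ≤ |t|})
  have hAcompl : Aᶜ = {h | |T.centred Λ x h| < K} := by
    ext h
    simp [hA]
  have hlarge : 1 / 2 ≤ μ A := by
    rw [← hAcompl, prob_compl_eq_one_sub hAm] at hsmall
    have h1 : (1 : ℝ≥0∞) / 2 + 1 / 2 ≤ 1 / 2 + μ A :=
      (ENNReal.add_halves 1).trans_le (tsub_le_iff_right.1 hsmall)
    exact (ENNReal.add_le_add_iff_left (by simp)).1 h1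
  refine (mul_le_mul_right hlarge _).trans ?_
  rw [← (hμ.isGradientGibbs T hφ).dlr Λ A hAm, ← lintegral_const_mul' _ _ (by simp)]
  refine lintegral_mono_ae (hmon.mono fun b hb => ?_)
  have hApi := gradSigma_le V _ hAm
  rw [evariance, ← setLIntegral_const, ← lintegral_indicator hApi]
  rw [T.localGibbs_eq Λ hb, lintegral_smul_measure, lintegral_smul_measure,
    lintegral_finsetSum_measure, lintegral_finsetSum_measure, ← T.localGibbs_eq Λ hb]
  refine mul_le_mul_right (Finset.sum_le_sum fun f hf => ?_) _
  have hWx : Measurable fun h : V → ℤ => (h x : ℝ) :=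
    measurable_from_top.comp (measurable_pi_apply x)
  rw [lintegral_dirac' _ (measurable_const.indicator hApi),
    lintegral_dirac' _ ((hWx.sub_const _).enorm.pow_const 2)]
  -- The mean is that of `b`, but it may be read off from `b + f`; this turns the deviation into a
  -- function of the configuration alone.
  have hval : (((b + f) x : ℤ) : ℝ) - ∫ h, (h x : ℝ) ∂T.localGibbs Λ b =
      T.centred Λ x (b + f) := by
    rw [T.centred_add x hf, ← T.centred_eq Λ x hb]
    simp only [Pi.add_apply, Int.cast_add]
    ring
  rw [hval]
  by_cases hbf : b + ⇑f ∈ A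
  · rw [Set.indicator_of_mem hbf]
    refine pow_le_pow_left' ?_ 2
    rw [Real.enorm_eq_ofReal_abs, ← ENNReal.ofReal_natCast]
    exact ENNReal.ofReal_le_ofReal hbf
  · rw [Set.indicator_of_notMem hbf]
    exact zero_le

end DirectedTree

theorem theorem2p10 {V : Type*} [Countable V] (T : DirectedTree V) (φ : V → ℝ≥0∞)
    (hφ : T.IsFlow φ) :
    -- the flow measure exists and is unique
    (∃! μ : @Measure (V → ℤ) (gradSigma V), T.IsFlowMeasure φ μ) ∧
    ∀ μ : @Measure (V → ℤ) (gradSigma V), T.IsFlowMeasure φ μ →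
      T.IsGradientGibbs μ ∧
      -- the localisation criterion, for some and for every vertex
      (T.Localised μ ↔ ∃ x, T.Criterion φ x) ∧
      (T.Localised μ ↔ ∀ x, T.Criterion φ x) ∧
      -- convergence: the limit along the ancestors is a height offset variable for the measure
      ((∃ x, T.Criterion φ x) →
        ∃ H : (V → ℤ) → EReal, IsHeightOffset H ∧ μ {h | H h < ⊤} = 1 ∧
          ∀ x, ∀ h ∈ T.monotoneFunctions,
            Tendsto (fun n : ℕ => (((h (T.parent^[n] x) : ℤ) : ℝ) : EReal)) atTop (𝓝 (H h))) ∧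
      -- divergence: the averaged finite-volume variances tend to infinity
      ((¬ ∃ x, T.Criterion φ x) →
        ∀ x, Tendsto
          (fun Λ : Finset V => ∫⁻ b, evariance (fun h : V → ℤ => (h x : ℝ)) (T.localGibbs Λ b) ∂μ)
          atTop (𝓝 ∞)) := by
  refine ⟨T.existsUnique_isFlowMeasure hφ, fun μ hμ => ?_⟩
  obtain ⟨o⟩ := T.isTree.connected.nonempty
  have hiff : T.Localised μ ↔ ∃ x, T.Criterion φ x :=
    ⟨fun h => ⟨o, by_contra fun ho => hμ.not_localised T hφ ho h⟩,
      fun ⟨_, hx⟩ => hμ.localised T hφ hx⟩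
  refine ⟨hμ.isGradientGibbs T hφ, hiff, hiff.trans
    ⟨fun ⟨_, hx⟩ => T.criterion_of_criterion hx, fun h => ⟨o, h o⟩⟩, fun ⟨x, hx⟩ => ?_,
    fun hdiv x => hμ.tendsto_lintegral_evariance T hφ fun hx => hdiv ⟨x, hx⟩⟩
  exact ⟨T.offset x, T.isHeightOffset_offset x, hμ.offset_lt_top T hφ hx,
    fun y h hh => T.tendsto_offset x y hh⟩
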